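/- Let $M$ be a compact smooth manifold without boundary, of dimension $n$, let $X_1,\dots,X_r$ be smooth vector fields on $M$, and let $dm$ be a smooth volume form on $M$ (a smooth positive density if $M$ is not orientable). The degeneration locus $Z$ is the set of points $p\in M$ at which the values $[X_{i_1},\dots,[X_{i_{k-1}},X_{i_k}]\dots](p)$ of the iterated commutators of all lengths $k\ge 1$ (those of length $1$ being the $X_j$ themselves) do not span $T_pM$. A characteristic submanifold is a nonempty smooth submanifold of $M$ of positive codimension to which each $X_j$ is tangent at each of its points; points are allowed as $0$-dimensional submanifolds. The Dirichlet energy ball is $$\mathcal B=\Big\{f\in L^2(M):\ X_jf\in L^2(M)\ \text{for all } j,\ \ \sum_{j=1}^r\int_M|X_jf|^2\,dm+\int_M|f|^2\,dm\le 1\Big\},$$ where $X_jf$ is the distributional derivative and the functions are real- or complex-valued. Suppose that $Z$ has nonempty interior. Then there is a nonempty open set $U\subseteq M$ contained in $Z$ and a smooth foliation of $U$, of some dimension $d<n$ (with $0\le d$), all of whose leaves are characteristic (embedded) submanifolds. Moreover, $\mathcal B$ is not precompact in $L^2(M)$, that is, its closure in $L^2(M)$ is not compact. -/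

import Mathlib

open scoped Manifold ContDiff
open MeasureTheory

noncomputable section

namespace DirichletEnergy

section Definitions

variable {n r : ℕ} {M : Type*} [TopologicalSpace M] [ChartedSpace (EuclideanSpace ℝ (Fin n)) M]

/-- `V` is a smooth vector field on `M`, i.e. a smooth section of the tangent bundle. -/
def IsSmoothVectorField [IsManifold (𝓡 n) ∞ M] (V : ∀ x : M, TangentSpace (𝓡 n) x) : Prop :=
  ContMDiff (𝓡 n) (𝓡 n).tangent ∞ (fun x : M => (⟨x, V x⟩ : TangentBundle (𝓡 n) M))

/-- The iterated commutator `[X i₁, [X i₂, … [X iₖ₋₁, X iₖ] … ]]` of the word `i₁ i₂ … iₖ`,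
`k ≥ 1`, given by its first letter and the list of the other ones. -/
def iteratedBracket (X : Fin r → ∀ x : M, TangentSpace (𝓡 n) x) :
    Fin r → List (Fin r) → ∀ x : M, TangentSpace (𝓡 n) x
  | i, [] => X i
  | i, j :: l => VectorField.mlieBracket (𝓡 n) (X i) (iteratedBracket X j l)

/-- The degeneration locus: the points at which the fields `X j` together with their iterated
commutators of arbitrary length do not span the tangent space. -/
def degenerationLocus (X : Fin r → ∀ x : M, TangentSpace (𝓡 n) x) : Set M :=
  {p | Submodule.span ℝ (Set.range fun w : Fin r × List (Fin r) =>
      iteratedBracket X w.1 w.2 p) ≠ ⊤}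

/-! ### Submanifolds, tangency, foliations -/

/-- The smooth chart `e` of `M` is a `k`-dimensional slice chart for `N`: it maps `N ∩ e.source`
onto the part of `e.target` where the last `n - k` coordinates vanish. -/
def IsSliceChart (k : ℕ) (N : Set M)
    (e : OpenPartialHomeomorph M (EuclideanSpace ℝ (Fin n))) : Prop :=
  e ∈ IsManifold.maximalAtlas (𝓡 n) ∞ M ∧
    e '' (N ∩ e.source) = {y | y ∈ e.target ∧ ∀ i : Fin n, k ≤ (i : ℕ) → y i = 0}

/-- `N` is a smooth (embedded, not necessarily closed) submanifold of `M` of dimension `k`. -/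
def IsSubmanifold (k : ℕ) (N : Set M) : Prop :=
  k ≤ n ∧ ∀ p ∈ N, ∃ e : OpenPartialHomeomorph M (EuclideanSpace ℝ (Fin n)),
    p ∈ e.source ∧ IsSliceChart k N e

/-- The differential at `p` of the chart `e`, applied to the tangent vector `v` at `p`: the
components of `v` in the coordinates `e`. -/
def chartComponents (e : OpenPartialHomeomorph M (EuclideanSpace ℝ (Fin n))) (p : M)
    (v : TangentSpace (𝓡 n) p) : EuclideanSpace ℝ (Fin n) :=
  mfderiv (𝓡 n) (𝓡 n) e p v

/-- The vector `v` at `p` is tangent to the `k`-dimensional submanifold `N ∋ p`: in a slice chart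
at `p` its last `n - k` components vanish. -/
def IsTangentAt (k : ℕ) (N : Set M) (p : M) (v : TangentSpace (𝓡 n) p) : Prop :=
  ∃ e : OpenPartialHomeomorph M (EuclideanSpace ℝ (Fin n)),
    p ∈ e.source ∧ IsSliceChart k N e ∧ ∀ i : Fin n, k ≤ (i : ℕ) → chartComponents e p v i = 0

/-- `N` is a `k`-dimensional characteristic submanifold for the vector fields `X j`: a nonempty
submanifold of positive codimension to which every `X j` is tangent at each of its points. -/
structure IsCharacteristicSubmanifold (X : Fin r → ∀ x : M, TangentSpace (𝓡 n) x)
    (k : ℕ) (N : Set M) : Prop where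
  nonempty : N.Nonempty
  lt_dim : k < n
  isSubmanifold : IsSubmanifold (n := n) k N
  tangent : ∀ p ∈ N, ∀ j : Fin r, IsTangentAt k N p (X j p)

/-- The smooth chart `e` is flat for the family `F` of `k`-dimensional leaves: its image is an open
box, and each leaf meets its domain in a countable (possibly empty) union of slices on which the
last `n - k` coordinates are constant. -/
def IsFlatChart (k : ℕ) (F : Set (Set M))
    (e : OpenPartialHomeomorph M (EuclideanSpace ℝ (Fin n))) : Prop :=
  e ∈ IsManifold.maximalAtlas (𝓡 n) ∞ M ∧
    (∃ a b : Fin n → ℝ, e.target = {y | ∀ i, y i ∈ Set.Ioo (a i) (b i)}) ∧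
    ∀ L ∈ F, ∃ C : Set (EuclideanSpace ℝ (Fin n)), C.Countable ∧
      e '' (L ∩ e.source) = {y | y ∈ e.target ∧ ∃ c ∈ C, ∀ i : Fin n, k ≤ (i : ℕ) → y i = c i}

/-- `F` is (the set of leaves of) a smooth `k`-dimensional foliation of `U ⊆ M`, all of whose
leaves are embedded: the leaves are disjoint connected nonempty `k`-dimensional submanifolds with
union `U`, and around each point of `U` there is a flat chart contained in `U`. -/
structure IsFoliation (n : ℕ) {M : Type*} [TopologicalSpace M]
    [ChartedSpace (EuclideanSpace ℝ (Fin n)) M] (k : ℕ) (U : Set M) (F : Set (Set M)) : Prop where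
  isConnected : ∀ L ∈ F, IsConnected L
  isSubmanifold : ∀ L ∈ F, IsSubmanifold (n := n) k L
  pairwiseDisjoint : F.PairwiseDisjoint id
  sUnion_eq : ⋃₀ F = U
  exists_flatChart : ∀ p ∈ U, ∃ e : OpenPartialHomeomorph M (EuclideanSpace ℝ (Fin n)),
    p ∈ e.source ∧ e.source ⊆ U ∧ IsFlatChart k F e

/-! ### Volume and Dirichlet energy -/

/-- `m` is (the measure given by) a smooth volume form, or a smooth positive density if `M` is
not orientable: in every smooth chart it is Lebesgue measure times a smooth positive function. -/
def IsSmoothVolume (n : ℕ) {M : Type*} [TopologicalSpace M]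
    [ChartedSpace (EuclideanSpace ℝ (Fin n)) M] [MeasurableSpace M] (m : Measure M) : Prop :=
  ∀ e ∈ IsManifold.maximalAtlas (𝓡 n) ∞ M, ∃ ρ : EuclideanSpace ℝ (Fin n) → ℝ,
    ContDiffOn ℝ ∞ ρ e.target ∧ (∀ y ∈ e.target, 0 < ρ y) ∧
    (m.restrict e.source).map e =
      (volume.restrict e.target).withDensity (fun y => ENNReal.ofReal (ρ y))

/-- `g` is the distributional derivative `V f`: in every smooth chart, writing
`V = ∑ i, b i ∂ᵢ`, one has `∫ φ g = - ∫ (∑ i, ∂ᵢ (φ b i)) f` for all test functions `φ`. -/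
def IsDistributionalDerivative {𝕜 : Type*} [RCLike 𝕜]
    (V : ∀ x : M, TangentSpace (𝓡 n) x) (f g : M → 𝕜) : Prop :=
  ∀ e ∈ IsManifold.maximalAtlas (𝓡 n) ∞ M, ∀ φ : EuclideanSpace ℝ (Fin n) → ℝ,
    ContDiff ℝ ∞ φ → HasCompactSupport φ → tsupport φ ⊆ e.target →
    ∫ y in e.target, φ y • g (e.symm y) =
      -∫ y in e.target,
        (∑ i : Fin n, fderiv ℝ
          (fun z => φ z * chartComponents e (e.symm z) (V (e.symm z)) i) y
            (EuclideanSpace.single i 1)) • f (e.symm y)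

/-- The Dirichlet energy ball: the `f ∈ L²` all of whose distributional derivatives `X j f` are in
`L²`, with `∑ j, ‖X j f‖² + ‖f‖² ≤ 1`. -/
def dirichletBall (𝕜 : Type*) [RCLike 𝕜] [MeasurableSpace M] (m : Measure M)
    (X : Fin r → ∀ x : M, TangentSpace (𝓡 n) x) : Set (Lp 𝕜 2 m) :=
  {f | ∃ g : Fin r → Lp 𝕜 2 m, (∀ j, IsDistributionalDerivative (X j) f (g j)) ∧
    ∑ j, ‖g j‖ ^ 2 + ‖f‖ ^ 2 ≤ 1}

end Definitions

end DirichletEnergy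

end

/-! The rank of the span of the iterated commutators is lower semicontinuous and is less than `n` on
the degeneration locus. At a point of the interior of the locus where this rank attains its maximum
`d` over the interior, `d` commutators that are independent there remain independent nearby, and by
maximality they still span all commutators. By the Jacobi identity the span is stable under brackets
(`mlieBracket_mem_bracketSpan`), so nearby it is an involutive distribution of constant rank `d <
n`. Frobenius' theorem gives a chart in which every `X j` has vanishing components from index `d` on
(`exists_adapted_chart`). After the chart is shrunk to a box, its plaques are the leaves of the
required foliation.

In such a chart the `X j` do not differentiate the coordinate of index `d`. The functions `χ cos (k
y_d)`, with `χ` a small cutoff, therefore have derivatives along the `X j` that are bounded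
uniformly in `k`, and they all lie in the Dirichlet ball. By the Riemann-Lebesgue lemma they are
asymptotically orthogonal, while their squared norms tend to half of `∫ χ²`, which is positive. In a
compact set an asymptotically orthogonal sequence has a subsequence tending to zero
(`IsCompact.exists_subseq_tendsto_zero_of_inner`), a contradiction.

Frobenius' theorem is proved for a distribution that is the graph of `A : E × F → (E →L F)`, that
is, for the total differential equation `D₁u = A (x, u)`. The equation is first solved along rays
from the origin, by applying the inverse function theorem in `C([0,1], F)`, which yields smooth
dependence on parameters (`exists_smooth_radial_solution`). Integrability then forces the defect in
the other directions to satisfy a linear homogeneous equation along each ray, hence to vanish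
(`fderiv_eq_of_radial`). -/

section

open Set Filter Topology

universe u

/-! ### A smooth inverse function theorem with smoothness on open sets -/

/-- The inverse function theorem, with smoothness on whole neighbourhoods. -/
theorem ContDiffOn.exists_openPartialHomeomorph {E F : Type*} [NormedAddCommGroup E]
    [NormedSpace ℝ E] [CompleteSpace E] [NormedAddCommGroup F] [NormedSpace ℝ F]
    {f : E → F} {s : Set E} {a : E} (hs : IsOpen s) (ha : a ∈ s) (hf : ContDiffOn ℝ ∞ f s)
    {f' : E ≃L[ℝ] F} (hf' : HasFDerivAt f (f' : E →L[ℝ] F) a) :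
    ∃ e : OpenPartialHomeomorph E F, (e : E → F) = f ∧ a ∈ e.source ∧ e.source ⊆ s ∧
      ContDiffOn ℝ ∞ e e.source ∧ ContDiffOn ℝ ∞ e.symm e.target := by
  have hfa : ContDiffAt ℝ ∞ f a := hf.contDiffAt (hs.mem_nhds ha)
  let e₀ := hfa.toOpenPartialHomeomorph f hf' (by simp)
  have hcont : ContinuousOn (fderiv ℝ f) s := hf.continuousOn_fderiv_of_isOpen hs (by simp)
  -- Keeping only the points where the derivative is invertible, an open condition, makes the
  -- inverse smooth at every point of the target and not just at the image of `a`.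
  let t : Set E := s ∩ fderiv ℝ f ⁻¹' range ((↑) : (E ≃L[ℝ] F) → E →L[ℝ] F)
  have ht : IsOpen t := hcont.isOpen_inter_preimage hs ContinuousLinearEquiv.isOpen
  have hat : a ∈ t := ⟨ha, f', hf'.fderiv.symm⟩
  have hsrc : (e₀.restrOpen t ht).source ⊆ s := fun x hx => by
    rw [OpenPartialHomeomorph.restrOpen_source] at hx
    exact hx.2.1
  refine ⟨e₀.restrOpen t ht, rfl, ?_, hsrc, hf.mono hsrc, ?_⟩
  · rw [OpenPartialHomeomorph.restrOpen_source]
    exact ⟨hfa.mem_toOpenPartialHomeomorph_source hf' (by simp), hat⟩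
  · intro y hy
    have hx := (e₀.restrOpen t ht).map_target hy
    have hx' := hx
    rw [OpenPartialHomeomorph.restrOpen_source] at hx
    obtain ⟨g, hg⟩ := hx.2.2
    refine ContDiffAt.contDiffWithinAt ?_
    refine (e₀.restrOpen t ht).contDiffAt_symm (f₀' := g) hy ?_
      (hf.contDiffAt (hs.mem_nhds (hsrc hx')))
    rw [hg]
    exact ((hf.contDiffAt (hs.mem_nhds (hsrc hx'))).differentiableAt (by simp)).hasFDerivAt

/-! ### Composition operators on spaces of continuous maps -/

section Nemytskii

variable {K : Type*} [TopologicalSpace K] [CompactSpace K]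

/-- Pointwise application of a continuous family of operators, as a bilinear map. -/
noncomputable def ContinuousMap.clmApply (K : Type*) [TopologicalSpace K] [CompactSpace K]
    (G H : Type*) [NormedAddCommGroup G] [NormedSpace ℝ G] [NormedAddCommGroup H]
    [NormedSpace ℝ H] : C(K, G →L[ℝ] H) →L[ℝ] C(K, G) →L[ℝ] C(K, H) :=
  LinearMap.mkContinuous₂
    (LinearMap.mk₂ ℝ (fun (φ : C(K, G →L[ℝ] H)) (h : C(K, G)) =>
        (⟨fun t => φ t (h t), by fun_prop⟩ : C(K, H)))
      (fun _ _ _ => by ext; simp) (fun _ _ _ => by ext; simp)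
      (fun _ _ _ => by ext; simp) (fun _ _ _ => by ext; simp)) 1 (fun φ h => by
    rw [one_mul]
    refine (ContinuousMap.norm_le _ (by positivity)).2 fun t => ?_
    refine ((φ t).le_opNorm _).trans ?_
    gcongr
    exacts [φ.norm_coe_le_norm t, h.norm_coe_le_norm t])

@[simp] theorem ContinuousMap.clmApply_apply {G H : Type*} [NormedAddCommGroup G]
    [NormedSpace ℝ G] [NormedAddCommGroup H] [NormedSpace ℝ H]
    (φ : C(K, G →L[ℝ] H)) (h : C(K, G)) (t : K) :
    ContinuousMap.clmApply K G H φ h t = φ t (h t) := rfl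

/-- The derivative `f'` is uniformly continuous near the compact set `range u`, so the mean value
inequality at each `t` gives a remainder bound that is uniform in `t`. -/
theorem ContinuousMap.hasFDerivAt_comp {G H : Type*} [NormedAddCommGroup G]
    [NormedSpace ℝ G] [NormedAddCommGroup H] [NormedSpace ℝ H] (f : C(G, H))
    (f' : C(G, G →L[ℝ] H)) (hf : ∀ x, HasFDerivAt f (f' x) x) (u : C(K, G)) :
    HasFDerivAt (fun v : C(K, G) => f.comp v) (ContinuousMap.clmApply K G H (f'.comp u)) u := by
  rw [hasFDerivAt_iff_isLittleO, Asymptotics.isLittleO_iff]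
  intro ε hε
  have hc : IsCompact (range u) := isCompact_range u.continuous
  have hmem := hc.uniformContinuousAt_of_continuousAt f' (fun x _ => f'.continuous.continuousAt)
    (Metric.dist_mem_uniformity hε)
  obtain ⟨δ, hδ, hδ'⟩ := Metric.mem_uniformity_dist.1 hmem
  filter_upwards [Metric.ball_mem_nhds u hδ] with v hv
  refine (ContinuousMap.norm_le _ (by positivity)).2 fun t => ?_
  have hvt : v t ∈ Metric.ball (u t) δ := (ContinuousMap.dist_apply_le_dist t).trans_lt hv
  have key := (convex_ball (u t) δ).norm_image_sub_le_of_norm_hasFDerivWithin_le'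
    (f := f) (f' := f') (φ := f' (u t)) (C := ε) (x := u t) (y := v t)
    (fun x _ => (hf x).hasFDerivWithinAt)
    (fun x hx => by
      have := hδ' (a := u t) (b := x) (by rw [dist_comm]; exact hx) ⟨t, rfl⟩
      rw [← dist_eq_norm, dist_comm]
      exact this.le) (Metric.mem_ball_self hδ) hvt
  calc _ ≤ ε * ‖v t - u t‖ := by simpa using key
    _ ≤ ε * ‖v - u‖ := by gcongr; exact (v - u).norm_coe_le_norm t

/-- The derivative of a composition operator is again a composition operator, with `f'` in place of
`f`, followed by a continuous linear map. This permits induction on the order with varying target;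
the common universe lets `G →L[ℝ] H` serve as the next target. -/
theorem ContinuousMap.contDiff_comp {G H : Type u} [NormedAddCommGroup G]
    [NormedSpace ℝ G] [NormedAddCommGroup H] [NormedSpace ℝ H] (f : C(G, H))
    (hf : ContDiff ℝ ∞ f) : ContDiff ℝ ∞ (fun v : C(K, G) => f.comp v) := by
  suffices h : ∀ (n : ℕ) {H : Type u} [NormedAddCommGroup H] [NormedSpace ℝ H] (f : C(G, H)),
      ContDiff ℝ ∞ f → ContDiff ℝ n (fun v : C(K, G) => f.comp v) from
    contDiff_infty.2 fun n => h n f hf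
  intro n
  induction n with
  | zero =>
    intro H _ _ f _
    exact contDiff_zero.2 (ContinuousMap.continuous_postcomp f)
  | succ n ih =>
    intro H _ _ f hf
    let f' : C(G, G →L[ℝ] H) := ⟨fderiv ℝ f, hf.continuous_fderiv (by simp)⟩
    have hf' : ContDiff ℝ ∞ f' := hf.fderiv_right (by simp)
    rw [Nat.cast_add, Nat.cast_one, contDiff_succ_iff_hasFDerivAt]
    have h : ContDiff ℝ n (⇑(ContinuousMap.clmApply K G H) ∘ fun u => f'.comp u) :=
      (ContinuousMap.clmApply K G H).contDiff.comp (ih f' hf')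
    exact ⟨fun u => ContinuousMap.clmApply K G H (f'.comp u), h, fun u =>
      ContinuousMap.hasFDerivAt_comp f f'
        (fun x => (hf.differentiable (by simp) x).hasFDerivAt) u⟩

end Nemytskii

/-! ### The radial equation -/

section Radial

open scoped unitInterval

/-- The primitive vanishing at `0`, as an operator on continuous functions on `[0, 1]`. -/
noncomputable def ContinuousMap.primitive (F : Type*) [NormedAddCommGroup F] [NormedSpace ℝ F] :
    C(I, F) →L[ℝ] C(I, F) :=
  LinearMap.mkContinuous
    { toFun := fun w => ⟨fun t => ∫ s in (0 : ℝ)..t, IccExtend zero_le_one w s,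
        (intervalIntegral.continuous_primitive
          (fun _ _ => (w.continuous.Icc_extend').intervalIntegrable _ _) 0).comp
            continuous_subtype_val⟩
      map_add' := fun v w => by
        ext t
        exact intervalIntegral.integral_add ((v.continuous.Icc_extend').intervalIntegrable _ _)
          ((w.continuous.Icc_extend').intervalIntegrable _ _)
      map_smul' := fun a w => by
        ext t
        exact intervalIntegral.integral_smul _ _ } 1 (fun w => by
    rw [one_mul]
    refine (ContinuousMap.norm_le _ (norm_nonneg _)).2 fun t => ?_
    refine (intervalIntegral.norm_integral_le_of_norm_le_const (C := ‖w‖)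
      fun s _ => w.norm_coe_le_norm _).trans ?_
    rw [sub_zero, abs_of_nonneg t.2.1]
    exact mul_le_of_le_one_right (norm_nonneg _) t.2.2)

theorem ContinuousMap.primitive_apply {F : Type*} [NormedAddCommGroup F] [NormedSpace ℝ F]
    (w : C(I, F)) (t : I) :
    ContinuousMap.primitive F w t = ∫ s in (0 : ℝ)..t, IccExtend zero_le_one w s := rfl

variable {E F : Type u} [NormedAddCommGroup E] [NormedSpace ℝ E]
  [NormedAddCommGroup F] [NormedSpace ℝ F]

/-- The curve `t ↦ (x, t x, v t)` attached to a parameter `(x, c)` and a curve `v`. -/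
noncomputable def rayCurve (E F : Type*) [NormedAddCommGroup E] [NormedSpace ℝ E]
    [NormedAddCommGroup F] [NormedSpace ℝ F] :
    ((E × F) × C(I, F)) →L[ℝ] C(I, E × E × F) :=
  LinearMap.mkContinuous
    { toFun := fun p => ⟨fun t => (p.1.1, (t : ℝ) • p.1.1, p.2 t), by fun_prop⟩
      map_add' := fun p q => by ext t <;> simp
      map_smul' := fun a p => ContinuousMap.ext fun t =>
        Prod.ext rfl (Prod.ext (smul_comm _ _ _) rfl) } 1 (fun p => by
    rw [one_mul]
    refine (ContinuousMap.norm_le _ (norm_nonneg _)).2 fun t => ?_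
    have h1 : ‖p.1.1‖ ≤ ‖p‖ := (norm_fst_le p.1).trans (norm_fst_le p)
    refine max_le h1 (max_le ?_ ((p.2.norm_coe_le_norm t).trans (norm_snd_le p)))
    refine le_trans ?_ h1
    change ‖(t : ℝ) • p.1.1‖ ≤ ‖p.1.1‖
    rw [norm_smul, Real.norm_of_nonneg t.2.1]
    exact mul_le_of_le_one_left (norm_nonneg _) t.2.2)

@[simp] theorem rayCurve_apply (p : (E × F) × C(I, F)) (t : I) :
    rayCurve E F p t = (p.1.1, (t : ℝ) • p.1.1, p.2 t) := rfl

variable [CompleteSpace E] [CompleteSpace F]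

/-- Solutions of `v' (t) = A (t x, v t) x`, `v 0 = c` on `[0, 1]` for small `(x, c)`, depending
smoothly on `(x, c)`, and unique among small curves. -/
theorem exists_smooth_radial_solution {A : E × F → E →L[ℝ] F} (hA : ContDiff ℝ ∞ A) :
    ∃ r > 0, ∃ δ > 0, ∃ S : E × F → C(I, F), r ≤ δ ∧ ContDiffOn ℝ ∞ S (Metric.ball 0 r) ∧
      ∀ p ∈ Metric.ball (0 : E × F) r, S p ∈ Metric.ball 0 δ ∧
        ∀ v ∈ Metric.ball (0 : C(I, F)) δ, v = S p ↔
          ∀ t : I, v t = p.2 + ∫ s in (0 : ℝ)..t,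
            A ((projIcc 0 1 zero_le_one s : ℝ) • p.1, IccExtend zero_le_one v s) p.1 := by
  let g : C(E × E × F, F) := ⟨fun q => A q.2 q.1, by have := hA.continuous; fun_prop⟩
  have hg : ContDiff ℝ ∞ g := (hA.comp contDiff_snd).clm_apply contDiff_fst
  -- The zeros of `Ψ` are the solutions of the integral equation. For `x = 0` the integral term
  -- vanishes, so the partial derivative in the curve at the origin is the identity, and the
  -- implicit function theorem applies in the form of inverting `Θ`.
  let Ψ : (E × F) × C(I, F) → C(I, F) := fun p =>
    p.2 - ContinuousMap.const I p.1.2 - ContinuousMap.primitive F (g.comp (rayCurve E F p))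
  have hconst : ContDiff ℝ ∞ (fun c : F => ContinuousMap.const I c) :=
    (IsBoundedLinearMap.contDiff (𝕜 := ℝ) (f := fun c : F => ContinuousMap.const I c)
      ⟨⟨fun _ _ => rfl, fun _ _ => rfl⟩, 1, one_pos, fun c => by
        rw [one_mul]
        exact (ContinuousMap.norm_le _ (norm_nonneg _)).2 fun _ => le_rfl⟩)
  have hN : ContDiff ℝ ∞ (fun p => ContinuousMap.primitive F (g.comp (rayCurve E F p))) :=
    (ContinuousMap.primitive F).contDiff.comp
      ((ContinuousMap.contDiff_comp g hg).comp (rayCurve E F).contDiff)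
  have hΨ : ContDiff ℝ ∞ Ψ :=
    (contDiff_snd.sub (hconst.comp (contDiff_snd.comp contDiff_fst))).sub hN
  have hΨd := (hΨ.differentiable (by simp) 0).hasFDerivAt
  set L := fderiv ℝ Ψ 0 with hL
  have hLinr : ∀ w, L (0, w) = w := by
    intro w
    have h1 : HasFDerivAt (fun w : C(I, F) => Ψ (0, w)) (L.comp (.inr ℝ _ _)) 0 :=
      HasFDerivAt.comp (g := Ψ) (0 : C(I, F)) hΨd (hasFDerivAt_prodMk_right 0 0)
    have h2 : (fun w : C(I, F) => Ψ (0, w)) = id := by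
      funext w
      ext t
      simp [Ψ, ContinuousMap.primitive_apply, g, IccExtend, Function.comp_def]
    rw [h2] at h1
    exact congrArg (fun T : C(I, F) →L[ℝ] C(I, F) => T w) (h1.unique (hasFDerivAt_id _))
  let Θ : (E × F) × C(I, F) → (E × F) × C(I, F) := fun p => (p.1, Ψ p)
  have hΘ : ContDiff ℝ ∞ Θ := contDiff_fst.prodMk hΨ
  let L' : ((E × F) × C(I, F)) ≃L[ℝ] ((E × F) × C(I, F)) :=
    (ContinuousLinearEquiv.refl ℝ (E × F)).skewProd (ContinuousLinearEquiv.refl ℝ C(I, F))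
      (L.comp (.inl ℝ _ _))
  have hΘd : HasFDerivAt Θ (L' : _ →L[ℝ] _) 0 := by
    have h1 : HasFDerivAt Θ ((ContinuousLinearMap.fst ℝ _ _).prod L) 0 :=
      hasFDerivAt_fst.prodMk hΨd
    convert h1 using 1
    refine ContinuousLinearMap.ext fun p => ?_
    have : L p = L (p.1, 0) + L (0, p.2) := by rw [← map_add]; simp
    ext1
    · rfl
    · change p.2 + L (p.1, 0) = L p
      rw [this, hLinr, add_comm]
  obtain ⟨e, he, h0, -, -, hsymm⟩ :=
    hΘ.contDiffOn.exists_openPartialHomeomorph isOpen_univ (mem_univ _) hΘd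
  have hΨ0 : Ψ 0 = 0 := by
    ext t
    simp [Ψ, g]
  have he0 : e 0 = 0 := by rw [he]; exact Prod.ext rfl hΨ0
  have ht0 : (0 : (E × F) × C(I, F)) ∈ e.target := he0 ▸ e.map_source h0
  have hs0 : e.symm 0 = 0 := by rw [← he0, e.left_inv h0, he0]
  obtain ⟨δ, hδ, hδs⟩ := Metric.isOpen_iff.1 e.open_source 0 h0
  have hcont : ContinuousAt (fun p : E × F => e.symm (p, (0 : C(I, F)))) 0 :=
    ContinuousAt.comp (g := e.symm) (f := fun p : E × F => (p, (0 : C(I, F))))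
      (e.continuousAt_symm ht0) (by fun_prop)
  have hev : ∀ᶠ p in 𝓝 (0 : E × F), (p, (0 : C(I, F))) ∈ e.target ∧
      e.symm (p, 0) ∈ Metric.ball 0 δ := by
    refine Filter.Eventually.and ?_ (hcont.eventually (Metric.isOpen_ball.mem_nhds ?_))
    · exact (Continuous.continuousAt (by fun_prop)).eventually (e.open_target.mem_nhds ht0)
    · change e.symm 0 ∈ _
      rw [hs0]
      exact Metric.mem_ball_self hδ
  obtain ⟨r, hr, hrT⟩ := Metric.eventually_nhds_iff_ball.1 hev
  have hmin : ∀ p ∈ Metric.ball (0 : E × F) (min r δ), p ∈ Metric.ball (0 : E × F) r ∧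
      p ∈ Metric.ball (0 : E × F) δ := fun p hp =>
    ⟨Metric.ball_subset_ball (min_le_left _ _) hp, Metric.ball_subset_ball (min_le_right _ _) hp⟩
  -- Requiring `p` to be `δ`-small as well puts `(p, v)` in the domain of injectivity of `Θ` for all
  -- `δ`-small `v`; this is what gives uniqueness.
  refine ⟨min r δ, lt_min hr hδ, δ, hδ, fun p => (e.symm (p, 0)).2, min_le_right _ _, ?_, ?_⟩
  · refine contDiff_snd.comp_contDiffOn (hsymm.comp (f := fun p : E × F => (p, (0 : C(I, F))))
      (contDiff_id.prodMk contDiff_const).contDiffOn fun p hp => (hrT p (hmin p hp).1).1)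
  · intro p hp
    obtain ⟨hpt, hpδ⟩ := hrT p (hmin p hp).1
    have hmem : ∀ (q : E × F) (v : C(I, F)), q ∈ Metric.ball (0 : E × F) δ →
        v ∈ Metric.ball (0 : C(I, F)) δ → (q, v) ∈ Metric.ball (0 : (E × F) × C(I, F)) δ := by
      intro q v hq hv
      rw [← Prod.mk_zero_zero, ← ball_prod_same]
      exact ⟨hq, hv⟩
    have hSδ : (e.symm (p, 0)).2 ∈ Metric.ball (0 : C(I, F)) δ := by
      rw [← Prod.mk_zero_zero, ← ball_prod_same] at hpδ
      exact hpδ.2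
    refine ⟨hSδ, fun v hv => ?_⟩
    have hfst : (e.symm (p, 0)).1 = p := by
      have := e.right_inv hpt
      rw [he] at this
      exact congrArg Prod.fst this
    have h1 : v = (e.symm (p, 0)).2 ↔ Ψ (p, v) = 0 := by
      constructor
      · intro h
        have h2 : (p, v) = e.symm (p, 0) := Prod.ext hfst.symm h
        have h3 := e.right_inv hpt
        rw [← h2, he] at h3
        exact congrArg Prod.snd h3
      · intro h
        have h2 : e (p, v) = (p, 0) := by rw [he]; exact Prod.ext rfl h
        rw [← h2, e.left_inv (hδs (hmem p v (hmin p hp).2 hv))]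
    rw [h1, ContinuousMap.ext_iff]
    refine forall_congr' fun t => ?_
    change v t - p.2 - (∫ s in (0 : ℝ)..t, IccExtend zero_le_one (g.comp (rayCurve E F (p, v))) s)
      = 0 ↔ _
    rw [sub_sub, sub_eq_zero]
    rfl

end Radial

/-! ### Frobenius' theorem for graphs: the total differential equation. -/

section Frobenius

open scoped unitInterval

variable {E F : Type u} [NormedAddCommGroup E] [NormedSpace ℝ E] [CompleteSpace E]
  [NormedAddCommGroup F] [NormedSpace ℝ F] [CompleteSpace F]

/-- A smooth family of maps solving `Dₓ u (x, c) x = A (x, u) x` and `u (0, c) = c`. -/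
theorem exists_radial_primitive {A : E × F → E →L[ℝ] F} (hA : ContDiff ℝ ∞ A) :
    ∃ r > 0, ∃ u : E × F → F, ContDiffOn ℝ ∞ u (Metric.ball 0 r) ∧
      (∀ c ∈ Metric.ball (0 : F) r, u (0, c) = c) ∧
      ∀ p ∈ Metric.ball (0 : E × F) r, fderiv ℝ u p (p.1, 0) = A (p.1, u p) p.1 := by
  obtain ⟨r, hr, δ, hδ, S, hrδ, hS, hsol⟩ := exists_smooth_radial_solution hA
  have hu : ContDiffOn ℝ ∞ (fun p => S p 1) (Metric.ball 0 r) :=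
    ContDiff.comp_contDiffOn (g := ContinuousMap.evalCLM ℝ (1 : I))
      (ContinuousLinearMap.contDiff _) hS
  have heq : ∀ p ∈ Metric.ball (0 : E × F) r, ∀ t : I, S p t = p.2 + ∫ s in (0 : ℝ)..t,
      A ((projIcc 0 1 zero_le_one s : ℝ) • p.1, IccExtend zero_le_one (S p) s) p.1 :=
    fun p hp => ((hsol p hp).2 _ (hsol p hp).1).1 rfl
  refine ⟨r, hr, fun p => S p 1, hu, ?_, ?_⟩
  · intro c hc
    have h0 : ((0 : E), c) ∈ Metric.ball (0 : E × F) r := by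
      rw [← Prod.mk_zero_zero, ← ball_prod_same]
      exact ⟨Metric.mem_ball_self hr, hc⟩
    have := heq (0, c) h0 1
    simpa using this
  · rintro ⟨x, c⟩ hp
    have hxc : x ∈ Metric.ball (0 : E) r ∧ c ∈ Metric.ball (0 : F) r := by
      rwa [← Prod.mk_zero_zero, ← ball_prod_same] at hp
    set v := S (x, c) with hv
    set h : ℝ → F := fun s =>
      A ((projIcc 0 1 zero_le_one s : ℝ) • x, IccExtend zero_le_one v s) x with hh
    have hhc : Continuous h := by
      have h1 : Continuous (IccExtend zero_le_one v) := v.continuous.Icc_extend'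
      have h2 := hA.continuous
      have h3 : Continuous (fun s => (projIcc (0 : ℝ) 1 zero_le_one s : ℝ)) :=
        continuous_subtype_val.comp continuous_projIcc
      fun_prop
    -- Homogeneity: the slowed-down curve `t ↦ v (s t)` is small and solves the equation with
    -- initial direction `s x`, so uniqueness identifies it. Values of `u` along a ray are thus
    -- values of a single curve.
    have hscale : ∀ s : I, S ((s : ℝ) • x, c) 1 = v s := by
      intro s
      have hmem : ((s : ℝ) • x, c) ∈ Metric.ball (0 : E × F) r := by
        rw [← Prod.mk_zero_zero, ← ball_prod_same]
        refine ⟨?_, hxc.2⟩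
        have := hxc.1
        rw [mem_ball_zero_iff] at this ⊢
        rw [norm_smul, Real.norm_of_nonneg s.2.1]
        exact (mul_le_of_le_one_left (norm_nonneg _) s.2.2).trans_lt this
      let w : C(I, F) := ⟨fun t => v (s * t), by fun_prop⟩
      have hw : w ∈ Metric.ball (0 : C(I, F)) δ := by
        have := (hsol _ hp).1
        rw [mem_ball_zero_iff] at this ⊢
        refine lt_of_le_of_lt ?_ this
        exact (ContinuousMap.norm_le _ (norm_nonneg _)).2 fun t => v.norm_coe_le_norm _
      have hwS : w = S ((s : ℝ) • x, c) := by
        refine ((hsol _ hmem).2 w hw).2 fun t => ?_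
        change v (s * t) = _
        rw [heq _ hp]
        change c + (∫ τ in (0 : ℝ)..(s * t : ℝ), h τ) = c + _
        congr 1
        have h1 := intervalIntegral.smul_integral_comp_mul_left (a := 0) (b := (t : ℝ)) h (s : ℝ)
        rw [mul_zero] at h1
        rw [← h1, ← intervalIntegral.integral_smul]
        refine intervalIntegral.integral_congr fun τ hτ => ?_
        rw [uIcc_of_le t.2.1] at hτ
        have hτI : τ ∈ Icc (0 : ℝ) 1 := ⟨hτ.1, hτ.2.trans t.2.2⟩
        have hsτ : (s : ℝ) * τ ∈ Icc (0 : ℝ) 1 := (s * ⟨τ, hτI⟩ : I).2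
        simp only [hh, IccExtend, Function.comp_apply, projIcc_of_mem _ hτI,
          projIcc_of_mem _ hsτ, map_smul]
        rw [smul_smul, mul_comm τ]
        rfl
      rw [← hwS]
      change v (s * 1) = v s
      rw [mul_one]
    have hd1 : HasDerivAt (fun s : ℝ => S (s • x, c) 1)
        (fderiv ℝ (fun p => S p 1) (x, c) (x, 0)) 1 := by
      have h1 : HasFDerivAt (fun p => S p 1) (fderiv ℝ (fun p => S p 1) (x, c))
          ((1 : ℝ) • x, c) := by
        rw [one_smul]
        exact ((hu.contDiffAt (Metric.isOpen_ball.mem_nhds hp)).differentiableAt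
          (by simp)).hasFDerivAt
      have h2 : HasDerivAt (fun s : ℝ => (s • x, c)) (x, (0 : F)) 1 := by
        have := ((hasDerivAt_id (1 : ℝ)).smul_const x).prodMk (hasDerivAt_const (1 : ℝ) c)
        simpa using this
      exact h1.comp_hasDerivAt (1 : ℝ) h2
    have hd2 : HasDerivAt (fun s : ℝ => c + ∫ τ in (0 : ℝ)..s, h τ) (h 1) 1 :=
      (hhc.integral_hasStrictDerivAt 0 1).hasDerivAt.const_add c
    -- The identity is known only for `s ≤ 1`, so the derivatives at `1` are compared within `[0,
    -- 1]`.
    have hd3 : HasDerivWithinAt (fun s : ℝ => S (s • x, c) 1) (h 1) (Icc 0 1) 1 := by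
      refine hd2.hasDerivWithinAt.congr_of_mem (fun s hs => ?_) (right_mem_Icc.2 zero_le_one)
      rw [hscale ⟨s, hs⟩, hv, heq _ hp]
    have := (uniqueDiffOn_Icc zero_lt_one 1 (right_mem_Icc.2 zero_le_one)).eq_deriv _
      hd1.hasDerivWithinAt hd3
    rw [this]
    have h1 : (1 : ℝ) ∈ Icc (0 : ℝ) 1 := right_mem_Icc.2 zero_le_one
    simp only [hh, IccExtend, Function.comp_apply, projIcc_of_mem _ h1, one_smul]
    rfl

/-- Under the integrability condition, solutions of the radial equation satisfy the full total
differential equation. -/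
theorem fderiv_eq_of_radial {A : E × F → E →L[ℝ] F} (hA : ContDiff ℝ ∞ A) {u : E × F → F}
    {r : ℝ} (hu : ContDiffOn ℝ ∞ u (Metric.ball 0 r))
    (hrad : ∀ p ∈ Metric.ball (0 : E × F) r, fderiv ℝ u p (p.1, 0) = A (p.1, u p) p.1)
    (hint : ∀ p ∈ Metric.ball (0 : E × F) r, ∀ a b,
      fderiv ℝ A (p.1, u p) (a, A (p.1, u p) a) b = fderiv ℝ A (p.1, u p) (b, A (p.1, u p) b) a) :
    ∀ p ∈ Metric.ball (0 : E × F) r, ∀ ξ, fderiv ℝ u p (ξ, 0) = A (p.1, u p) ξ := by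
  have hAd : ∀ z, HasFDerivAt A (fderiv ℝ A z) z := fun z =>
    (hA.differentiable (by simp) z).hasFDerivAt
  have hnhds : ∀ p ∈ Metric.ball (0 : E × F) r, Metric.ball (0 : E × F) r ∈ 𝓝 p := fun p hp =>
    Metric.isOpen_ball.mem_nhds hp
  have hud : ∀ p ∈ Metric.ball (0 : E × F) r, HasFDerivAt u (fderiv ℝ u p) p := fun p hp =>
    ((hu.contDiffAt (hnhds p hp)).differentiableAt (by simp)).hasFDerivAt
  have hud2 : ∀ p ∈ Metric.ball (0 : E × F) r,
      HasFDerivAt (fderiv ℝ u) (fderiv ℝ (fderiv ℝ u) p) p := fun p hp =>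
    (((hu.contDiffAt (hnhds p hp)).fderiv_right (m := ∞) (by simp)).differentiableAt
      (by simp)).hasFDerivAt
  have hcomp : ∀ p ∈ Metric.ball (0 : E × F) r, HasFDerivAt (fun q : E × F => A (q.1, u q))
      ((fderiv ℝ A (p.1, u p)).comp ((ContinuousLinearMap.fst ℝ E F).prod (fderiv ℝ u p))) p :=
    fun p hp => HasFDerivAt.comp (g := A) p (hAd _) (hasFDerivAt_fst.prodMk (hud p hp))
  -- The defect in direction `ξ` is `k = Du (ξ, 0) - A ξ`. Its derivative along the ray is found by
  -- differentiating the radial identity in direction `ξ`, then using the symmetry of `D²u` and the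
  -- integrability condition to exchange `ξ` with `x`.
  have hk : ∀ p ∈ Metric.ball (0 : E × F) r, ∀ ξ, ∃ T : E × F →L[ℝ] F,
      HasFDerivAt (fun q : E × F => fderiv ℝ u q (ξ, 0) - A (q.1, u q) ξ) T p ∧
      T (p.1, 0) = -(fderiv ℝ u p (ξ, 0) - A (p.1, u p) ξ) +
        fderiv ℝ A (p.1, u p) (0, fderiv ℝ u p (ξ, 0) - A (p.1, u p) ξ) p.1 := by
    intro p hp ξ
    refine ⟨_, ((hud2 p hp).clm_apply (hasFDerivAt_const _ _)).sub
      ((hcomp p hp).clm_apply (hasFDerivAt_const _ _)), ?_⟩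
    have hR : HasFDerivAt (fun q : E × F => fderiv ℝ u q (q.1, 0) - A (q.1, u q) q.1)
        (0 : E × F →L[ℝ] F) p := by
      refine (hasFDerivAt_const (0 : F) p).congr_of_eventuallyEq ?_
      filter_upwards [hnhds p hp] with q hq
      rw [hrad q hq, sub_self]
    have hR' := ((hud2 p hp).clm_apply
      (hasFDerivAt_fst.prodMk (hasFDerivAt_const (0 : F) p))).sub
      ((hcomp p hp).clm_apply hasFDerivAt_fst)
    have h1 := congrArg (fun T : E × F →L[ℝ] F => T (ξ, 0)) (hR'.unique hR)
    have hsymm := ((hu.contDiffAt (hnhds p hp)).isSymmSndFDerivAt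
      (by simpa using ENat.LEInfty.out)).eq (ξ, 0) (p.1, 0)
    have h2 := hint p hp ξ p.1
    have h3 := hrad p hp
    simp at h1 ⊢
    rw [h3, hsymm.symm, ← h2]
    have h4 : ((0 : E), fderiv ℝ u p (ξ, 0) - A (p.1, u p) ξ) =
      (ξ, fderiv ℝ u p (ξ, 0)) - (ξ, A (p.1, u p) ξ) := by simp
    rw [h4, map_sub]
    simp
    refine sub_eq_zero.1 (Eq.trans ?_ h1)
    abel
  rintro ⟨x, c⟩ hp ξ
  have hxc : x ∈ Metric.ball (0 : E) r ∧ c ∈ Metric.ball (0 : F) r := by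
    rwa [← Prod.mk_zero_zero, ← ball_prod_same] at hp
  have hmem : ∀ s ∈ Icc (0 : ℝ) 1, (s • x, c) ∈ Metric.ball (0 : E × F) r := by
    intro s hs
    rw [← Prod.mk_zero_zero, ← ball_prod_same]
    refine ⟨?_, hxc.2⟩
    have := hxc.1
    rw [mem_ball_zero_iff] at this ⊢
    rw [norm_smul, Real.norm_of_nonneg hs.1]
    exact (mul_le_of_le_one_left (norm_nonneg _) hs.2).trans_lt this
  set k : ℝ → F := fun s => fderiv ℝ u (s • x, c) (ξ, 0) - A (s • x, u (s • x, c)) ξ with hkdef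
  -- The factor `s` absorbs the term `-k`: the product `s k (s)` solves a linear homogeneous
  -- equation and vanishes at `0`, so Grönwall's inequality kills it up to `s = 1`.
  have hKd : ∀ s ∈ Icc (0 : ℝ) 1, HasDerivAt (fun s => s • k s)
      (fderiv ℝ A (s • x, u (s • x, c)) (0, s • k s) x) s := by
    intro s hs
    obtain ⟨T, hT, hT'⟩ := hk _ (hmem s hs) ξ
    have h2 : HasDerivAt (fun s : ℝ => (s • x, c)) (x, (0 : F)) s := by
      have := ((hasDerivAt_id s).smul_const x).prodMk (hasDerivAt_const s c)
      simpa using this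
    have h3 : HasDerivAt k (T (x, 0)) s :=
      HasFDerivAt.comp_hasDerivAt (f := fun s : ℝ => (s • x, c)) s hT h2
    have h4 := (hasDerivAt_id s).smul h3
    have h5 : s • T (x, 0) = -k s + fderiv ℝ A (s • x, u (s • x, c)) (0, k s) (s • x) := by
      rw [← map_smul, Prod.smul_mk, smul_zero]
      exact hT'
    have h6 : ((0 : E), s • k s) = s • ((0 : E), k s) := by simp
    have h7 : fderiv ℝ A (s • x, u (s • x, c)) (0, s • k s) x =
        s • T (x, 0) + (1 : ℝ) • k s := by
      rw [h5, one_smul, neg_add_cancel_comm, h6, map_smul, map_smul]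
      rfl
    rw [h7]
    exact h4
  have hcont : ContinuousOn (fun s : ℝ => ‖fderiv ℝ A (s • x, u (s • x, c))‖ * ‖x‖) (Icc 0 1) := by
    have h1 : ContinuousOn (fun s : ℝ => u (s • x, c)) (Icc 0 1) :=
      hu.continuousOn.comp (f := fun s : ℝ => (s • x, c)) (by fun_prop) hmem
    have h2 : Continuous (fun z => ‖fderiv ℝ A z‖) := (hA.continuous_fderiv (by simp)).norm
    have h3 : ContinuousOn (fun s : ℝ => (s • x, u (s • x, c))) (Icc 0 1) :=
      ContinuousOn.prodMk (by fun_prop) h1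
    exact (h2.comp_continuousOn h3).mul continuousOn_const
  obtain ⟨C, hC⟩ := (isCompact_Icc (a := (0 : ℝ)) (b := 1)).exists_bound_of_continuousOn hcont
  have hzero := eq_zero_of_abs_deriv_le_mul_abs_self_of_eq_zero_right (K := C)
    (f := fun s => s • k s) (a := 0) (b := 1)
    (fun s hs => (hKd s hs).continuousAt.continuousWithinAt)
    (fun s hs => (hKd s (Ico_subset_Icc_self hs)).hasDerivWithinAt) (zero_smul _ _)
    (fun s hs => by
      have h1 := hC s (Ico_subset_Icc_self hs)
      rw [Real.norm_of_nonneg (by positivity)] at h1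
      refine (ContinuousLinearMap.le_opNorm _ _).trans ?_
      refine (mul_le_mul_of_nonneg_right (ContinuousLinearMap.le_opNorm _ _)
        (norm_nonneg x)).trans ?_
      rw [Prod.norm_mk, norm_zero, max_eq_right (norm_nonneg _), mul_right_comm]
      exact mul_le_mul_of_nonneg_right h1 (norm_nonneg _)) 1 (right_mem_Icc.2 zero_le_one)
  simpa [hkdef, sub_eq_zero] using hzero

/-- **Frobenius' theorem** for a distribution given as the graph of `A`. -/
theorem exists_straightening {E F : Type u} [NormedAddCommGroup E] [NormedSpace ℝ E]
    [FiniteDimensional ℝ E] [NormedAddCommGroup F] [NormedSpace ℝ F] [FiniteDimensional ℝ F]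
    {A : E × F → E →L[ℝ] F} {O : Set (E × F)} (hO : IsOpen O) (hA : ContDiffOn ℝ ∞ A O)
    (hint : ∀ z ∈ O, ∀ a b, fderiv ℝ A z (a, A z a) b = fderiv ℝ A z (b, A z b) a)
    {z₀ : E × F} (hz₀ : z₀ ∈ O) :
    ∃ e : OpenPartialHomeomorph (E × F) (E × F), z₀ ∈ e.source ∧ e.source ⊆ O ∧
      ContDiffOn ℝ ∞ e e.source ∧ ContDiffOn ℝ ∞ e.symm e.target ∧
      ∀ z ∈ e.source, ∀ ξ, fderiv ℝ e z (ξ, A z ξ) = (ξ, 0) := by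
  have : CompleteSpace E := FiniteDimensional.complete ℝ E
  have : CompleteSpace F := FiniteDimensional.complete ℝ F
  obtain ⟨ε, hε, hεO⟩ := Metric.isOpen_iff.1 hO z₀ hz₀
  -- The radial equation is solved for globally smooth coefficients centred at `0`; the bump
  -- function and the translation achieve this without changing `A` near `z₀`.
  let χ : ContDiffBump z₀ := ⟨ε / 3, ε / 2, by positivity, by linarith⟩
  have hχ : ContDiff ℝ ∞ (fun z => χ z • A z) := by
    refine contMDiff_iff_contDiff.1 (contMDiff_of_tsupport fun z hz => ContDiffAt.contMDiffAt ?_)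
    have hz' : z ∈ O := by
      have := tsupport_smul_subset_left _ _ hz
      rw [χ.tsupport_eq] at this
      exact hεO (Metric.closedBall_subset_ball (by simp [χ]; linarith) this)
    exact χ.contDiffAt.smul (hA.contDiffAt (hO.mem_nhds hz'))
  let A' : E × F → E →L[ℝ] F := fun z => χ (z₀ + z) • A (z₀ + z)
  have hA' : ContDiff ℝ ∞ A' := hχ.comp (contDiff_const.add contDiff_id)
  have hev : ∀ z ∈ Metric.ball (0 : E × F) (ε / 3), A' =ᶠ[𝓝 z] fun z => A (z₀ + z) := by
    intro z hz
    filter_upwards [Metric.isOpen_ball.mem_nhds hz] with y hy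
    have : z₀ + y ∈ Metric.closedBall z₀ χ.rIn := by
      simpa [χ] using (mem_ball_zero_iff.1 hy).le
    simp [A', χ.one_of_mem_closedBall this]
  obtain ⟨r, hr, u, hu, hu0, hrad⟩ := exists_radial_primitive hA'
  have hu00 : u 0 = 0 := hu0 0 (Metric.mem_ball_self hr)
  have h0r : (0 : E × F) ∈ Metric.ball (0 : E × F) r := Metric.mem_ball_self hr
  have hucont : ContinuousAt u 0 := (hu.contDiffAt (Metric.isOpen_ball.mem_nhds h0r)).continuousAt
  have hev2 : ∀ᶠ p in 𝓝 (0 : E × F), p ∈ Metric.ball (0 : E × F) r ∧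
      (p.1, u p) ∈ Metric.ball (0 : E × F) (ε / 3) := by
    have h1 : ContinuousAt (fun p : E × F => (p.1, u p)) 0 := continuousAt_fst.prodMk hucont
    refine Filter.Eventually.and (Metric.isOpen_ball.mem_nhds h0r)
      (h1.eventually (Metric.isOpen_ball.mem_nhds ?_))
    simp [hu00, hε]
  obtain ⟨ρ, hρ, hρs⟩ := Metric.eventually_nhds_iff_ball.1 hev2
  have hsub : Metric.ball (0 : E × F) ρ ⊆ Metric.ball 0 r := fun p hp => (hρs p hp).1
  have hfull := fderiv_eq_of_radial hA' (hu.mono hsub) (fun p hp => hrad p (hsub hp))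
    (fun p hp a b => by
      have h1 := hev _ (hρs p hp).2
      have h2 : z₀ + (p.1, u p) ∈ O := hεO (by
        have := mem_ball_zero_iff.1 (hρs p hp).2
        simp only [Metric.mem_ball, dist_self_add_left]
        linarith)
      rw [h1.fderiv_eq, h1.eq_of_nhds, fderiv_comp_add_left]
      exact hint _ h2 a b)
  -- For fixed `c`, `x ↦ Φ (x, c)` parametrizes an integral manifold, and `DΦ (ξ, 0) = (ξ, A ξ)`.
  -- The inverse of `Φ` is the straightening; since `u (0, c) = c`, the derivative at the origin is
  -- triangular with identity diagonal blocks.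
  let Φ : E × F → E × F := fun p => z₀ + (p.1, u p)
  have hΦ : ContDiffOn ℝ ∞ Φ (Metric.ball 0 ρ) :=
    contDiffOn_const.add (contDiffOn_fst.prodMk (hu.mono hsub))
  have hud : ∀ p ∈ Metric.ball (0 : E × F) ρ, HasFDerivAt u (fderiv ℝ u p) p := fun p hp =>
    ((hu.contDiffAt (Metric.isOpen_ball.mem_nhds (hsub hp))).differentiableAt
      (by simp)).hasFDerivAt
  have hΦd : ∀ p ∈ Metric.ball (0 : E × F) ρ,
      HasFDerivAt Φ ((ContinuousLinearMap.fst ℝ E F).prod (fderiv ℝ u p)) p := fun p hp =>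
    (hasFDerivAt_fst.prodMk (hud p hp)).const_add z₀
  have h0ρ : (0 : E × F) ∈ Metric.ball (0 : E × F) ρ := Metric.mem_ball_self hρ
  have hinr : ∀ c, fderiv ℝ u 0 (0, c) = c := by
    have h1 : HasFDerivAt (fun c : F => u (0, c)) ((fderiv ℝ u 0).comp (.inr ℝ _ _)) 0 :=
      HasFDerivAt.comp (g := u) (0 : F) (hud 0 h0ρ) (hasFDerivAt_prodMk_right 0 0)
    have h2 : (fun c : F => u (0, c)) =ᶠ[𝓝 0] id := by
      filter_upwards [Metric.ball_mem_nhds (0 : F) hr] with c hc using hu0 c hc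
    intro c
    exact congrArg (fun T : F →L[ℝ] F => T c)
      (h1.unique ((hasFDerivAt_id (𝕜 := ℝ) (0 : F)).congr_of_eventuallyEq h2))
  let L : (E × F) ≃L[ℝ] (E × F) :=
    (ContinuousLinearEquiv.refl ℝ E).skewProd (ContinuousLinearEquiv.refl ℝ F)
      ((fderiv ℝ u 0).comp (.inl ℝ _ _))
  have hΦ0 : HasFDerivAt Φ (L : E × F →L[ℝ] E × F) 0 := by
    convert hΦd 0 h0ρ using 1
    refine ContinuousLinearMap.ext fun p => ?_
    have : fderiv ℝ u 0 p = fderiv ℝ u 0 (p.1, 0) + fderiv ℝ u 0 (0, p.2) := by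
      rw [← map_add]; simp
    ext1
    · rfl
    · change p.2 + fderiv ℝ u 0 (p.1, 0) = fderiv ℝ u 0 p
      rw [this, hinr, add_comm]
  obtain ⟨e, he, h0, hes, hsm, hsymm⟩ :=
    hΦ.exists_openPartialHomeomorph Metric.isOpen_ball h0ρ hΦ0
  have hΦ00 : Φ 0 = z₀ := by simp [Φ, hu00]
  have hmemO : ∀ p ∈ Metric.ball (0 : E × F) ρ, Φ p ∈ O := fun p hp => hεO (by
    have := mem_ball_zero_iff.1 (hρs p hp).2
    simp only [Φ, Metric.mem_ball, dist_self_add_left]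
    linarith)
  refine ⟨e.symm, ?_, ?_, hsymm, by simpa using hsm, ?_⟩
  · rw [e.symm_source, ← hΦ00, ← he]
    exact e.map_source h0
  · intro z hz
    rw [e.symm_source] at hz
    rw [← e.right_inv hz, he]
    exact hmemO _ (hes (e.map_target hz))
  · intro z hz ξ
    rw [e.symm_source] at hz
    have hp := hes (e.map_target hz)
    have hzΦ : Φ (e.symm z) = z := by rw [← he, e.right_inv hz]
    have hz' : A' ((e.symm z).1, u (e.symm z)) = A z := by
      rw [(hev _ (hρs _ hp).2).eq_of_nhds]
      exact congrArg A hzΦ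
    have hsd : HasFDerivAt e.symm (fderiv ℝ e.symm z) z :=
      ((hsymm.contDiffAt (e.open_target.mem_nhds hz)).differentiableAt (by simp)).hasFDerivAt
    have hcomp : HasFDerivAt (e.symm ∘ Φ) (ContinuousLinearMap.id ℝ (E × F)) (e.symm z) := by
      refine (hasFDerivAt_id _).congr_of_eventuallyEq ?_
      filter_upwards [e.open_source.mem_nhds (e.map_target hz)] with p hp'
      change e.symm (Φ p) = p
      rw [← he, e.left_inv hp']
    have hcomp' := HasFDerivAt.comp (g := e.symm) (e.symm z) (by rw [hzΦ]; exact hsd) (hΦd _ hp)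
    have := congrArg (fun T : E × F →L[ℝ] E × F => T (ξ, 0)) (hcomp'.unique hcomp)
    simp only [ContinuousLinearMap.comp_apply, ContinuousLinearMap.prod_apply,
      ContinuousLinearMap.coe_fst', ContinuousLinearMap.id_apply] at this
    rwa [hfull _ hp, hz'] at this

end Frobenius

/-! ### Frobenius' theorem for involutive frames. -/

section Involutive

/-- A `d`-dimensional subspace can be moved onto the first factor of a product. -/
theorem exists_continuousLinearEquiv_snd_eq_zero {d m : ℕ}
    {W : Submodule ℝ (EuclideanSpace ℝ (Fin (d + m)))} (hW : Module.finrank ℝ W = d) :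
    ∃ T : EuclideanSpace ℝ (Fin (d + m)) ≃L[ℝ] EuclideanSpace ℝ (Fin d) × EuclideanSpace ℝ (Fin m),
      ∀ v ∈ W, (T v).2 = 0 := by
  obtain ⟨W', hWW'⟩ := W.exists_isCompl
  have hW' : Module.finrank ℝ W' = m := by
    have := Submodule.finrank_add_eq_of_isCompl hWW'
    rw [hW, finrank_euclideanSpace_fin] at this
    omega
  let e₁ : W ≃ₗ[ℝ] EuclideanSpace ℝ (Fin d) := LinearEquiv.ofFinrankEq _ _ (by simp [hW])
  let e₂ : W' ≃ₗ[ℝ] EuclideanSpace ℝ (Fin m) := LinearEquiv.ofFinrankEq _ _ (by simp [hW'])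
  refine ⟨((W.prodEquivOfIsCompl W' hWW').symm.trans
    (e₁.prodCongr e₂)).toContinuousLinearEquiv, fun v hv => ?_⟩
  have : (W.prodEquivOfIsCompl W' hWW').symm v = (⟨v, hv⟩, 0) :=
    Submodule.prodEquivOfIsCompl_symm_apply_left _ _ hWW' (⟨v, hv⟩ : W)
  simp [this]

/-- The inclusion of a product as consecutive blocks of coordinates. -/
theorem exists_continuousLinearEquiv_apply_eq_zero (d m : ℕ) :
    ∃ R : (EuclideanSpace ℝ (Fin d) × EuclideanSpace ℝ (Fin m)) ≃L[ℝ]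
        EuclideanSpace ℝ (Fin (d + m)),
      ∀ p, p.2 = 0 → ∀ i : Fin (d + m), d ≤ (i : ℕ) → R p i = 0 := by
  refine ⟨(EuclideanSpace.finAddEquivProd (𝕜 := ℝ) (n := d) (m := m)).symm, ?_⟩
  intro p hp i hi
  obtain ⟨j, rfl⟩ : ∃ j : Fin m, i = Fin.natAdd d j := ⟨⟨i - d, by omega⟩, by ext; simp; omega⟩
  simp [hp]

/-- The linear combinations of the values at `z` of the fields `Y i`. -/
noncomputable def frameMap {d : ℕ} {V : Type*} [NormedAddCommGroup V] [NormedSpace ℝ V]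
    (Y : Fin d → V → V) (z : V) : EuclideanSpace ℝ (Fin d) →L[ℝ] V :=
  ∑ i, ContinuousLinearMap.smulRightL ℝ _ _ (EuclideanSpace.proj i) (Y i z)

theorem frameMap_apply {d : ℕ} {V : Type*} [NormedAddCommGroup V] [NormedSpace ℝ V]
    (Y : Fin d → V → V) (z : V) (c : EuclideanSpace ℝ (Fin d)) :
    frameMap Y z c = ∑ i, c i • Y i z := by
  simp [frameMap]

/-- **Frobenius' theorem**: an involutive family of independent smooth vector fields can be
straightened. -/
theorem exists_straightening_of_involutive_add {d m : ℕ}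
    {Y : Fin d → EuclideanSpace ℝ (Fin (d + m)) → EuclideanSpace ℝ (Fin (d + m))}
    {O : Set (EuclideanSpace ℝ (Fin (d + m)))} (hO : IsOpen O)
    (hY : ∀ i, ContDiffOn ℝ ∞ (Y i) O) {z₀ : EuclideanSpace ℝ (Fin (d + m))} (hz₀ : z₀ ∈ O)
    (hli : LinearIndependent ℝ (fun i => Y i z₀))
    (hbr : ∀ z ∈ O, ∀ i j, VectorField.lieBracket ℝ (Y i) (Y j) z ∈
      Submodule.span ℝ (range fun k => Y k z)) :
    ∃ e : OpenPartialHomeomorph (EuclideanSpace ℝ (Fin (d + m))) (EuclideanSpace ℝ (Fin (d + m))),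
      z₀ ∈ e.source ∧ e.source ⊆ O ∧ ContDiffOn ℝ ∞ e e.source ∧ ContDiffOn ℝ ∞ e.symm e.target ∧
      ∀ z ∈ e.source, ∀ k, ∀ i : Fin (d + m), d ≤ (i : ℕ) → fderiv ℝ e z (Y k z) i = 0 := by
  obtain ⟨T, hT⟩ := exists_continuousLinearEquiv_snd_eq_zero
    (W := Submodule.span ℝ (range fun k => Y k z₀))
    ((finrank_span_eq_card hli).trans (Fintype.card_fin d))
  let E := EuclideanSpace ℝ (Fin d)
  let F := EuclideanSpace ℝ (Fin m)
  let V := EuclideanSpace ℝ (Fin (d + m))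
  let T₁ : V →L[ℝ] E := (ContinuousLinearMap.fst ℝ E F).comp (T : V →L[ℝ] E × F)
  let T₂ : V →L[ℝ] F := (ContinuousLinearMap.snd ℝ E F).comp (T : V →L[ℝ] E × F)
  have hframe : ContDiffOn ℝ ∞ (frameMap Y) O := by
    refine ContDiffOn.sum fun i _ => ?_
    exact ContDiff.comp_contDiffOn
      (g := ContinuousLinearMap.smulRightL ℝ E V (EuclideanSpace.proj i))
      (ContinuousLinearMap.contDiff _) (hY i)
  let P : V → E →L[ℝ] E := fun z => T₁.comp (frameMap Y z)
  have hP : ContDiffOn ℝ ∞ P O := contDiffOn_const.clm_comp hframe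
  -- On this open set the span of the `Y k` projects isomorphically onto the first factor, so it is
  -- the graph of the map `A` below.
  let O' : Set V := O ∩ P ⁻¹' range ((↑) : (E ≃L[ℝ] E) → E →L[ℝ] E)
  have hO' : IsOpen O' := hP.continuousOn.isOpen_inter_preimage hO ContinuousLinearEquiv.isOpen
  have hinj : ∀ z, LinearIndependent ℝ (fun i => Y i z) ↔ Function.Injective (frameMap Y z) := by
    intro z
    rw [Fintype.linearIndependent_iff, injective_iff_map_eq_zero]
    constructor
    · intro h c hc
      rw [frameMap_apply] at hc
      ext i
      exact h _ hc i
    · intro h g hg i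
      have := h (WithLp.toLp 2 g) (by rw [frameMap_apply]; exact hg)
      exact congrArg (fun c : EuclideanSpace ℝ (Fin d) => c i) this
  have hz₀' : z₀ ∈ O' := by
    refine ⟨hz₀, ?_⟩
    have hPi : Function.Injective (P z₀) := by
      refine (injective_iff_map_eq_zero _).2 fun c hc => ?_
      have h1 : frameMap Y z₀ c ∈ Submodule.span ℝ (range fun k => Y k z₀) := by
        rw [frameMap_apply]
        exact Submodule.sum_mem _ fun i _ => Submodule.smul_mem _ _
          (Submodule.subset_span ⟨i, rfl⟩)
      have h2 : T (frameMap Y z₀ c) = 0 := Prod.ext hc (hT _ h1)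
      rw [map_eq_zero_iff _ T.injective] at h2
      exact (injective_iff_map_eq_zero _).1 ((hinj z₀).1 hli) c h2
    exact ⟨(LinearEquiv.ofInjectiveEndo (P z₀ : E →ₗ[ℝ] E) hPi).toContinuousLinearEquiv,
      ContinuousLinearMap.ext fun _ => rfl⟩
  let A : V → E →L[ℝ] F := fun z => (T₂.comp (frameMap Y z)).comp (P z).inverse
  have hA : ContDiffOn ℝ ∞ A O' := by
    refine (contDiffOn_const.clm_comp (hframe.mono inter_subset_left)).clm_comp ?_
    intro z hz
    obtain ⟨g, hg⟩ := hz.2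
    have h1 : ContDiffAt ℝ ∞ ContinuousLinearMap.inverse (P z) := by
      rw [← hg]; exact contDiffAt_map_inverse g
    exact h1.comp_contDiffWithinAt z ((hP.mono inter_subset_left) z hz)
  have hgraph : ∀ z ∈ O', ∀ c, T₂ (frameMap Y z c) = A z (T₁ (frameMap Y z c)) := by
    intro z hz c
    obtain ⟨g, hg⟩ := hz.2
    change _ = T₂ (frameMap Y z ((P z).inverse (P z c)))
    rw [← hg, ContinuousLinearMap.inverse_equiv]
    simp
  have hgraph' : ∀ z ∈ O', ∀ ξ, ∃ c, T.symm (ξ, A z ξ) = frameMap Y z c := by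
    intro z hz ξ
    obtain ⟨g, hg⟩ := hz.2
    refine ⟨g.symm ξ, ?_⟩
    rw [ContinuousLinearEquiv.symm_apply_eq]
    have h1 : P z (g.symm ξ) = ξ := by rw [← hg]; simp
    refine Prod.ext h1.symm ?_
    change _ = T₂ (frameMap Y z (g.symm ξ))
    rw [hgraph z hz]
    change _ = A z (P z (g.symm ξ))
    rw [h1]
  have hspan : ∀ z ∈ O', ∀ v ∈ Submodule.span ℝ (range fun k => Y k z), T₂ v = A z (T₁ v) := by
    intro z hz v hv
    have : Submodule.span ℝ (range fun k => Y k z) ≤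
        LinearMap.ker ((T₂ - (A z).comp T₁ : V →L[ℝ] F) : V →ₗ[ℝ] F) := by
      rw [Submodule.span_le]
      rintro _ ⟨k, rfl⟩
      have := hgraph z hz (EuclideanSpace.single k 1)
      simp [frameMap_apply] at this
      simp [this]
    simpa [sub_eq_zero] using this hv
  have hYd : ∀ z ∈ O', ∀ i, HasFDerivAt (Y i) (fderiv ℝ (Y i) z) z := fun z hz i =>
    (((hY i).contDiffAt (hO.mem_nhds hz.1)).differentiableAt (by simp)).hasFDerivAt
  have hAd : ∀ z ∈ O', HasFDerivAt A (fderiv ℝ A z) z := fun z hz =>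
    ((hA.contDiffAt (hO'.mem_nhds hz)).differentiableAt (by simp)).hasFDerivAt
  have hmemY : ∀ z k, Y k z ∈ Submodule.span ℝ (range fun k => Y k z) := fun z k =>
    Submodule.subset_span ⟨k, rfl⟩
  -- Differentiate `T₂ (Y k) = A (T₁ (Y k))` along `Y j` and antisymmetrize. The bracket lies in the
  -- graph too, so the terms with derivatives of the fields cancel and only the symmetry of `DA` is
  -- left, which is the integrability condition.
  have hsymY : ∀ z ∈ O', ∀ j k, fderiv ℝ A z (Y j z) (T₁ (Y k z)) =
      fderiv ℝ A z (Y k z) (T₁ (Y j z)) := by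
    intro z hz j k
    have hdiff : ∀ k v, T₂ (fderiv ℝ (Y k) z v) =
        A z (T₁ (fderiv ℝ (Y k) z v)) + fderiv ℝ A z v (T₁ (Y k z)) := by
      intro k v
      have h1 : HasFDerivAt (fun y => T₂ (Y k y)) (T₂.comp (fderiv ℝ (Y k) z)) z :=
        T₂.hasFDerivAt.comp z (hYd z hz k)
      have h2 : HasFDerivAt (fun y => T₁ (Y k y)) (T₁.comp (fderiv ℝ (Y k) z)) z :=
        T₁.hasFDerivAt.comp z (hYd z hz k)
      have h3 := (hAd z hz).clm_apply h2
      have h4 : (fun y => T₂ (Y k y)) =ᶠ[𝓝 z] fun y => A y (T₁ (Y k y)) := by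
        filter_upwards [hO'.mem_nhds hz] with y hy using hspan y hy _ (hmemY y k)
      have := congrArg (fun L : V →L[ℝ] F => L v) (h1.unique (h3.congr_of_eventuallyEq h4))
      simpa using this
    have h1 := hspan z hz _ (hbr z hz.1 j k)
    rw [VectorField.lieBracket_eq] at h1
    simp only [map_sub, hdiff] at h1
    have := sub_eq_zero.2 h1
    rw [← sub_eq_zero, ← this]
    abel
  have hsym : ∀ z ∈ O', ∀ c c', fderiv ℝ A z (frameMap Y z c) (T₁ (frameMap Y z c')) =
      fderiv ℝ A z (frameMap Y z c') (T₁ (frameMap Y z c)) := by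
    intro z hz c c'
    simp only [frameMap_apply, map_sum, map_smul, sum_apply,
      smul_apply, Finset.smul_sum]
    rw [Finset.sum_comm]
    refine Finset.sum_congr rfl fun i _ => Finset.sum_congr rfl fun j _ => ?_
    rw [hsymY z hz, smul_comm]
  have hAT : ContDiffOn ℝ ∞ (A ∘ T.symm) (T.symm ⁻¹' O') :=
    hA.comp T.symm.contDiff.contDiffOn (mapsTo_preimage _ _)
  have hATd : ∀ w ∈ T.symm ⁻¹' O', ∀ v,
      fderiv ℝ (A ∘ T.symm) w v = fderiv ℝ A (T.symm w) (T.symm v) := by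
    intro w hw v
    rw [((hAd _ hw).comp w T.symm.hasFDerivAt).fderiv]
    rfl
  obtain ⟨Φ, hΦ0, hΦO, hΦ, hΦs, hΦd⟩ := exists_straightening (A := A ∘ T.symm)
    (hO'.preimage T.symm.continuous) hAT (fun w hw a b => by
      rw [hATd w hw, hATd w hw]
      obtain ⟨c, hc⟩ := hgraph' _ hw a
      obtain ⟨c', hc'⟩ := hgraph' _ hw b
      have := hsym _ hw c c'
      rw [← hc, ← hc'] at this
      simpa [T₁] using this) (z₀ := T z₀) (by simpa using hz₀')
  obtain ⟨R, hR⟩ := exists_continuousLinearEquiv_apply_eq_zero d m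
  have hTz : ∀ z, T z ∈ T.symm ⁻¹' O' ↔ z ∈ O' := fun z => by simp
  let e := (T.toHomeomorph.transOpenPartialHomeomorph Φ).transHomeomorph R.toHomeomorph
  refine ⟨e, hΦ0, fun z hz => ((hTz z).1 (hΦO hz)).1, ?_, ?_, fun z hz k i hi => ?_⟩
  · exact R.contDiff.comp_contDiffOn (hΦ.comp T.contDiff.contDiffOn fun z hz => hz)
  · exact T.symm.contDiff.comp_contDiffOn (hΦs.comp R.symm.contDiff.contDiffOn fun z hz => hz)
  · have hzO := (hTz z).1 (hΦO hz)
    have hd : HasFDerivAt Φ (fderiv ℝ Φ (T z)) (T z) :=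
      ((hΦ.contDiffAt (Φ.open_source.mem_nhds hz)).differentiableAt (by simp)).hasFDerivAt
    have hd' : HasFDerivAt e ((R : E × F →L[ℝ] V).comp ((fderiv ℝ Φ (T z)).comp
        (T : V →L[ℝ] E × F))) z :=
      R.hasFDerivAt.comp z (hd.comp z T.hasFDerivAt)
    rw [hd'.fderiv]
    refine hR _ ?_ i hi
    have h1 : T (Y k z) = (T₁ (Y k z), (A ∘ T.symm) (T z) (T₁ (Y k z))) := by
      refine Prod.ext rfl ?_
      change T₂ (Y k z) = A (T.symm (T z)) (T₁ (Y k z))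
      rw [T.symm_apply_apply]
      exact hspan z hzO _ (hmemY z k)
    change (fderiv ℝ Φ (T z) (T (Y k z))).2 = 0
    rw [h1, hΦd (T z) hz]

/-- **Frobenius' theorem**: an involutive family of independent smooth vector fields can be
straightened. -/
theorem exists_straightening_of_involutive {n d : ℕ} (hdn : d ≤ n)
    {Y : Fin d → EuclideanSpace ℝ (Fin n) → EuclideanSpace ℝ (Fin n)}
    {O : Set (EuclideanSpace ℝ (Fin n))} (hO : IsOpen O)
    (hY : ∀ i, ContDiffOn ℝ ∞ (Y i) O) {z₀ : EuclideanSpace ℝ (Fin n)} (hz₀ : z₀ ∈ O)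
    (hli : LinearIndependent ℝ (fun i => Y i z₀))
    (hbr : ∀ z ∈ O, ∀ i j, VectorField.lieBracket ℝ (Y i) (Y j) z ∈
      Submodule.span ℝ (range fun k => Y k z)) :
    ∃ e : OpenPartialHomeomorph (EuclideanSpace ℝ (Fin n)) (EuclideanSpace ℝ (Fin n)),
      z₀ ∈ e.source ∧ e.source ⊆ O ∧ ContDiffOn ℝ ∞ e e.source ∧ ContDiffOn ℝ ∞ e.symm e.target ∧
      ∀ z ∈ e.source, ∀ k, ∀ i : Fin n, d ≤ (i : ℕ) → fderiv ℝ e z (Y k z) i = 0 := by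
  obtain ⟨m, rfl⟩ := Nat.exists_eq_add_of_le hdn
  exact exists_straightening_of_involutive_add hO hY hz₀ hli hbr

end Involutive

namespace DirichletEnergy

open VectorField

/-! ### The span of the iterated commutators. -/

section Brackets

variable {n r : ℕ} {M : Type*} [TopologicalSpace M] [ChartedSpace (EuclideanSpace ℝ (Fin n)) M]
  [IsManifold (𝓡 n) ∞ M]

theorem IsSmoothVectorField.mlieBracket {V W : ∀ x : M, TangentSpace (𝓡 n) x}
    (hV : IsSmoothVectorField V) (hW : IsSmoothVectorField W) :
    IsSmoothVectorField (mlieBracket (𝓡 n) V W) := by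
  have : IsManifold (𝓡 n) (minSmoothness ℝ 2) M := by
    rw [minSmoothness_of_isRCLikeNormedField]
    exact IsManifold.of_le (n := ∞) ENat.LEInfty.out
  have : IsManifold (𝓡 n) (((⊤ : ℕ∞) : WithTop ℕ∞) + 1) M := ‹IsManifold (𝓡 n) ∞ M›
  exact fun x => ContMDiffAt.mlieBracket_vectorField (m := ⊤) (n := ⊤) (hV x) (hW x) (by simp)

theorem isSmoothVectorField_iteratedBracket {X : Fin r → ∀ x : M, TangentSpace (𝓡 n) x}
    (hX : ∀ j, IsSmoothVectorField (X j)) (i : Fin r) (l : List (Fin r)) :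
    IsSmoothVectorField (iteratedBracket X i l) := by
  induction l generalizing i with
  | nil => exact hX i
  | cons j l ih => exact (hX i).mlieBracket (ih j)

/-- The fields which are linear combinations, with constant coefficients, of the iterated
brackets. -/
noncomputable def bracketSpan (X : Fin r → ∀ x : M, TangentSpace (𝓡 n) x) :
    Submodule ℝ (∀ x : M, TangentSpace (𝓡 n) x) :=
  Submodule.span ℝ (range fun w : Fin r × List (Fin r) => iteratedBracket X w.1 w.2)

theorem isSmoothVectorField_of_mem_bracketSpan {X : Fin r → ∀ x : M, TangentSpace (𝓡 n) x}
    (hX : ∀ j, IsSmoothVectorField (X j)) {V : ∀ x : M, TangentSpace (𝓡 n) x}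
    (hV : V ∈ bracketSpan X) : IsSmoothVectorField V := by
  induction hV using Submodule.span_induction with
  | mem V h =>
    obtain ⟨w, rfl⟩ := h
    exact isSmoothVectorField_iteratedBracket hX _ _
  | zero => exact Bundle.contMDiff_zeroSection ℝ (TangentSpace (𝓡 n) : M → Type _)
  | add V W _ _ h1 h2 => exact ContMDiff.add_section h1 h2
  | smul a V _ h => exact ContMDiff.const_smul_section h

theorem IsSmoothVectorField.mdifferentiableAt {V : ∀ x : M, TangentSpace (𝓡 n) x}
    (hV : IsSmoothVectorField V) (x : M) :
    MDifferentiableAt (𝓡 n) (𝓡 n).tangent (fun x : M => (⟨x, V x⟩ : TangentBundle (𝓡 n) M)) x :=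
  (hV x).mdifferentiableAt (by simp)

/-- The commutators are nested to the right, so bracketing with `X i` prepends a letter to the word.
With constant coefficients, linearity suffices and no Leibniz rule is needed. -/
theorem mlieBracket_field_mem_bracketSpan {X : Fin r → ∀ x : M, TangentSpace (𝓡 n) x}
    (hX : ∀ j, IsSmoothVectorField (X j)) (i : Fin r) {V : ∀ x : M, TangentSpace (𝓡 n) x}
    (hV : V ∈ bracketSpan X) : mlieBracket (𝓡 n) (X i) V ∈ bracketSpan X := by
  induction hV using Submodule.span_induction with
  | mem V h =>
    obtain ⟨w, rfl⟩ := h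
    exact Submodule.subset_span ⟨(i, w.1 :: w.2), rfl⟩
  | zero => 
    rw [mlieBracket_zero_right]
    exact Submodule.zero_mem _
  | add V W hV hW h1 h2 =>
    have : mlieBracket (𝓡 n) (X i) (V + W) =
        mlieBracket (𝓡 n) (X i) V + mlieBracket (𝓡 n) (X i) W := funext fun x =>
      mlieBracket_add_right ((isSmoothVectorField_of_mem_bracketSpan hX hV).mdifferentiableAt x)
        ((isSmoothVectorField_of_mem_bracketSpan hX hW).mdifferentiableAt x)
    rw [this]
    exact Submodule.add_mem _ h1 h2
  | smul a V hV h =>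
    have : mlieBracket (𝓡 n) (X i) (a • V) = a • mlieBracket (𝓡 n) (X i) V := funext fun x =>
      mlieBracket_const_smul_right
        ((isSmoothVectorField_of_mem_bracketSpan hX hV).mdifferentiableAt x)
    rw [this]
    exact Submodule.smul_mem _ _ h

/-- The span of the iterated brackets is stable under brackets. -/
theorem mlieBracket_mem_bracketSpan {X : Fin r → ∀ x : M, TangentSpace (𝓡 n) x}
    (hX : ∀ j, IsSmoothVectorField (X j)) (i : Fin r) (l : List (Fin r))
    {V : ∀ x : M, TangentSpace (𝓡 n) x} (hV : V ∈ bracketSpan X) :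
    mlieBracket (𝓡 n) (iteratedBracket X i l) V ∈ bracketSpan X := by
  induction l generalizing i V with
  | nil => exact mlieBracket_field_mem_bracketSpan hX i hV
  | cons j l ih =>
    have : IsManifold (𝓡 n) (minSmoothness ℝ 3) M := by
      rw [minSmoothness_of_isRCLikeNormedField]
      exact IsManifold.of_le (n := ∞) ENat.LEInfty.out
    have hle : minSmoothness ℝ 2 ≤ ∞ := by
      rw [minSmoothness_of_isRCLikeNormedField]; exact ENat.LEInfty.out
    have hJ := leibniz_identity_mlieBracket (I := 𝓡 n) (U := X i) (V := iteratedBracket X j l)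
      (W := V) ((hX i).of_le hle) ((isSmoothVectorField_iteratedBracket hX j l).of_le hle)
      ((isSmoothVectorField_of_mem_bracketSpan hX hV).of_le hle)
    -- The Jacobi identity shortens the word on the left; the induction is over all `V` because the
    -- second term uses it for `[X i, V]`.
    have : mlieBracket (𝓡 n) (iteratedBracket X i (j :: l)) V =
        mlieBracket (𝓡 n) (X i) (mlieBracket (𝓡 n) (iteratedBracket X j l) V) -
        mlieBracket (𝓡 n) (iteratedBracket X j l) (mlieBracket (𝓡 n) (X i) V) := by
      rw [hJ, add_sub_cancel_right]
      rfl
    rw [this]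
    exact Submodule.sub_mem _ (mlieBracket_field_mem_bracketSpan hX i (ih j hV))
      (ih j (mlieBracket_field_mem_bracketSpan hX i hV))

/-- The space spanned at `p` by the iterated brackets. -/
noncomputable def bracketSpanAt (X : Fin r → ∀ x : M, TangentSpace (𝓡 n) x) (p : M) :
    Submodule ℝ (TangentSpace (𝓡 n) p) :=
  Submodule.span ℝ (range fun w : Fin r × List (Fin r) => iteratedBracket X w.1 w.2 p)

theorem apply_mem_bracketSpanAt {X : Fin r → ∀ x : M, TangentSpace (𝓡 n) x}
    {V : ∀ x : M, TangentSpace (𝓡 n) x} (hV : V ∈ bracketSpan X) (p : M) :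
    V p ∈ bracketSpanAt X p := by
  induction hV using Submodule.span_induction with
  | mem V h =>
    obtain ⟨w, rfl⟩ := h
    exact Submodule.subset_span ⟨w, rfl⟩
  | zero => exact Submodule.zero_mem _
  | add V W _ _ h1 h2 => exact Submodule.add_mem _ h1 h2
  | smul a V _ h => exact Submodule.smul_mem _ _ h

end Brackets

open VectorField

/-! ### Vector fields in charts. -/

section Charts

variable {n r : ℕ} {M : Type*} [TopologicalSpace M] [ChartedSpace (EuclideanSpace ℝ (Fin n)) M]
  [IsManifold (𝓡 n) ∞ M]
  {e : OpenPartialHomeomorph M (EuclideanSpace ℝ (Fin n))}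

theorem mdifferentiable_of_mem_maximalAtlas (he : e ∈ IsManifold.maximalAtlas (𝓡 n) ∞ M) :
    e.MDifferentiable (𝓡 n) (𝓡 n) :=
  ⟨(contMDiffOn_of_mem_maximalAtlas he).mdifferentiableOn (by simp),
    (contMDiffOn_symm_of_mem_maximalAtlas he).mdifferentiableOn (by simp)⟩

/-- The expression of a vector field in a chart. -/
noncomputable def chartField (e : OpenPartialHomeomorph M (EuclideanSpace ℝ (Fin n)))
    (V : ∀ x : M, TangentSpace (𝓡 n) x) (y : EuclideanSpace ℝ (Fin n)) :
    EuclideanSpace ℝ (Fin n) :=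
  chartComponents e (e.symm y) (V (e.symm y))

theorem isInvertible_mfderiv_symm (he : e ∈ IsManifold.maximalAtlas (𝓡 n) ∞ M)
    {y : EuclideanSpace ℝ (Fin n)} (hy : y ∈ e.target) :
    (mfderiv (𝓡 n) (𝓡 n) e.symm y).IsInvertible :=
  ⟨(mdifferentiable_of_mem_maximalAtlas he).symm.mfderiv hy, rfl⟩

/-- The differentials of `e` and `e.symm` are mutually inverse. Writing components as a pullback
gives access to the smoothness of pullbacks and their compatibility with brackets. -/
theorem chartField_eq_mpullback (he : e ∈ IsManifold.maximalAtlas (𝓡 n) ∞ M)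
    (V : ∀ x : M, TangentSpace (𝓡 n) x) {y : EuclideanSpace ℝ (Fin n)} (hy : y ∈ e.target) :
    chartField e V y = mpullback (𝓡 n) (𝓡 n) e.symm V y := by
  have h1 := (mdifferentiable_of_mem_maximalAtlas he).comp_symm_deriv hy
  obtain ⟨g, hg⟩ := isInvertible_mfderiv_symm he hy
  rw [mpullback_apply, ← hg, ContinuousLinearMap.inverse_equiv]
  change mfderiv (𝓡 n) (𝓡 n) e (e.symm y) (V (e.symm y)) = g.symm (V (e.symm y))
  rw [← hg] at h1
  have h2 := congrArg (fun T => T (g.symm (V (e.symm y)))) h1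
  simp only [ContinuousLinearMap.comp_apply, ContinuousLinearEquiv.coe_coe,
    ContinuousLinearEquiv.apply_symm_apply] at h2
  exact h2

theorem contDiffOn_chartField (he : e ∈ IsManifold.maximalAtlas (𝓡 n) ∞ M)
    {V : ∀ x : M, TangentSpace (𝓡 n) x} (hV : IsSmoothVectorField V) :
    ContDiffOn ℝ ∞ (chartField e V) e.target := by
  refine ContDiffOn.congr (f := mpullback (𝓡 n) (𝓡 n) e.symm V) (fun y hy => ?_)
    fun y hy => chartField_eq_mpullback he V hy
  refine ContDiffAt.contDiffWithinAt (contMDiffAt_vectorSpace_iff_contDiffAt.1 ?_)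
  exact ContMDiffAt.mpullback_vectorField_preimage (n := ∞) (hV _)
    (contMDiffAt_symm_of_mem_maximalAtlas he hy) (isInvertible_mfderiv_symm he hy) (by simp)

theorem lieBracket_chartField (he : e ∈ IsManifold.maximalAtlas (𝓡 n) ∞ M)
    {V W : ∀ x : M, TangentSpace (𝓡 n) x} (hV : IsSmoothVectorField V)
    (hW : IsSmoothVectorField W) {y : EuclideanSpace ℝ (Fin n)} (hy : y ∈ e.target) :
    lieBracket ℝ (chartField e V) (chartField e W) y =
      chartField e (mlieBracket (𝓡 n) V W) y := by
  have : IsManifold (𝓡 n) (minSmoothness ℝ 3) M := by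
    rw [minSmoothness_of_isRCLikeNormedField]
    exact IsManifold.of_le (n := ∞) ENat.LEInfty.out
  have hev : ∀ V : ∀ x : M, TangentSpace (𝓡 n) x,
      chartField e V =ᶠ[𝓝 y] mpullback (𝓡 n) (𝓡 n) e.symm V := fun V => by
    filter_upwards [e.open_target.mem_nhds hy] with z hz using chartField_eq_mpullback he V hz
  rw [chartField_eq_mpullback he _ hy, mpullback_mlieBracket (n := ∞) (hV.mdifferentiableAt _)
    (hW.mdifferentiableAt _) (contMDiffAt_symm_of_mem_maximalAtlas he hy)
    (by rw [minSmoothness_of_isRCLikeNormedField]; exact ENat.LEInfty.out)]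
  refine ((hev V).lieBracket_vectorField_eq (hev W)).trans ?_
  rw [← mlieBracketWithin_univ]
  refine Eq.trans ?_ (congrFun mlieBracketWithin_eq_lieBracketWithin.symm y)
  exact (congrFun lieBracketWithin_univ y).symm

/-- Both transition maps gain a factor from the smooth groupoid. This makes a chart followed by a
Frobenius straightening, a translation or a restriction a chart of `M` again. -/
theorem trans_mem_maximalAtlas (he : e ∈ IsManifold.maximalAtlas (𝓡 n) ∞ M)
    {g : OpenPartialHomeomorph (EuclideanSpace ℝ (Fin n)) (EuclideanSpace ℝ (Fin n))}
    (hg : ContDiffOn ℝ ∞ g g.source) (hg' : ContDiffOn ℝ ∞ g.symm g.target) :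
    e.trans g ∈ IsManifold.maximalAtlas (𝓡 n) ∞ M := by
  have hgG : g ∈ contDiffGroupoid ∞ (𝓡 n) := by
    rw [contDiffGroupoid, mem_groupoid_of_pregroupoid]
    constructor
    · change ContDiffOn ℝ ∞ _ _
      simpa using hg
    · change ContDiffOn ℝ ∞ _ _
      simpa using hg'
  have hgG' := (contDiffGroupoid ∞ (𝓡 n)).symm hgG
  rw [IsManifold.mem_maximalAtlas_iff, mem_maximalAtlas_iff] at he ⊢
  intro e' he'
  have h1 : (e.trans g).symm.trans e' = g.symm.trans (e.symm.trans e') := by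
    rw [OpenPartialHomeomorph.trans_symm_eq_symm_trans_symm, OpenPartialHomeomorph.trans_assoc]
  have h2 : e'.symm.trans (e.trans g) = (e'.symm.trans e).trans g :=
    (OpenPartialHomeomorph.trans_assoc _ _ _).symm
  rw [h1, h2]
  exact ⟨(contDiffGroupoid ∞ (𝓡 n)).trans hgG' (he e' he').1,
    (contDiffGroupoid ∞ (𝓡 n)).trans (he e' he').2 hgG⟩

theorem chartComponents_trans (he : e ∈ IsManifold.maximalAtlas (𝓡 n) ∞ M)
    {g : OpenPartialHomeomorph (EuclideanSpace ℝ (Fin n)) (EuclideanSpace ℝ (Fin n))}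
    {p : M} (hp : p ∈ e.source) (hg : DifferentiableAt ℝ g (e p)) (v : TangentSpace (𝓡 n) p) :
    chartComponents (e.trans g) p v = fderiv ℝ g (e p) (chartComponents e p v) := by
  have h1 := (mdifferentiable_of_mem_maximalAtlas he).mdifferentiableAt hp
  unfold chartComponents
  rw [OpenPartialHomeomorph.coe_trans, mfderiv_comp p hg.mdifferentiableAt h1, mfderiv_eq_fderiv]
  rfl

end Charts
open VectorField

/-! ### A chart adapted to the commutators near a point of maximal rank. -/

section AdaptedChart

variable {n r : ℕ} {M : Type*} [TopologicalSpace M] [ChartedSpace (EuclideanSpace ℝ (Fin n)) M]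
  [IsManifold (𝓡 n) ∞ M]

instance (p : M) : FiniteDimensional ℝ (TangentSpace (𝓡 n) p) :=
  inferInstanceAs (FiniteDimensional ℝ (EuclideanSpace ℝ (Fin n)))

theorem finrank_tangentSpace (p : M) : Module.finrank ℝ (TangentSpace (𝓡 n) p) = n :=
  finrank_euclideanSpace_fin (𝕜 := ℝ)

/-- In the interior of the degeneration locus there is a chart in which the last components of the
fields `X j` vanish. -/
theorem exists_adapted_chart {X : Fin r → ∀ x : M, TangentSpace (𝓡 n) x}
    (hX : ∀ j, IsSmoothVectorField (X j)) (hZ : (interior (degenerationLocus X)).Nonempty) :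
    ∃ d < n, ∃ e ∈ IsManifold.maximalAtlas (𝓡 n) ∞ M, e.source.Nonempty ∧
      e.source ⊆ degenerationLocus X ∧
      ∀ p ∈ e.source, ∀ j, ∀ i : Fin n, d ≤ (i : ℕ) → chartComponents e p (X j p) i = 0 := by
  -- A point of maximal rank in the interior of the locus, found by minimizing the corank, a natural
  -- number.
  obtain ⟨p₀, hp₀, hmax⟩ : ∃ p₀ ∈ interior (degenerationLocus X), ∀ p ∈ interior
      (degenerationLocus X), Module.finrank ℝ (bracketSpanAt X p) ≤
        Module.finrank ℝ (bracketSpanAt X p₀) := by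
    obtain ⟨p₀, hp₀, h⟩ := (measure fun p : M =>
      n - Module.finrank ℝ (bracketSpanAt X p)).wf.has_min _ hZ
    refine ⟨p₀, hp₀, fun p hp => ?_⟩
    have h1 := h p hp
    have h2 := (Submodule.finrank_le (bracketSpanAt X p)).trans_eq (finrank_tangentSpace p)
    have h3 : ¬ (n - Module.finrank ℝ (bracketSpanAt X p) <
      n - Module.finrank ℝ (bracketSpanAt X p₀)) := h1
    omega
  set d := Module.finrank ℝ (bracketSpanAt X p₀) with hd
  have hdn : d < n := by
    have := Submodule.finrank_lt (s := bracketSpanAt X p₀)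
      (interior_subset hp₀)
    rwa [finrank_tangentSpace] at this
  obtain ⟨w, hw⟩ : ∃ w : Fin d → Fin r × List (Fin r),
      LinearIndependent ℝ fun i => iteratedBracket X (w i).1 (w i).2 p₀ := by
    obtain ⟨κ, a, -, hspan, hli⟩ := exists_linearIndependent' ℝ
      (fun w : Fin r × List (Fin r) => iteratedBracket X w.1 w.2 p₀)
    have : Fintype κ := @Fintype.ofFinite _ hli.finite
    have hcard : Fintype.card κ = d := by
      rw [hd, bracketSpanAt, ← hspan, finrank_span_eq_card hli]
    let σ : Fin d ≃ κ := (Fintype.equivFinOfCardEq hcard).symm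
    exact ⟨a ∘ σ, hli.comp σ σ.injective⟩
  let B : Fin d → ∀ x : M, TangentSpace (𝓡 n) x := fun i => iteratedBracket X (w i).1 (w i).2
  have hB : ∀ i, IsSmoothVectorField (B i) := fun i => isSmoothVectorField_iteratedBracket hX _ _
  have hBmem : ∀ i, B i ∈ bracketSpan X := fun i => Submodule.subset_span ⟨w i, rfl⟩
  let e₀ := chartAt (EuclideanSpace ℝ (Fin n)) p₀
  have he₀ : e₀ ∈ IsManifold.maximalAtlas (𝓡 n) ∞ M := IsManifold.chart_mem_maximalAtlas p₀
  let Y : Fin d → EuclideanSpace ℝ (Fin n) → EuclideanSpace ℝ (Fin n) := fun i => chartField e₀ (B i)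
  have hY : ∀ i, ContDiffOn ℝ ∞ (Y i) e₀.target := fun i => contDiffOn_chartField he₀ (hB i)
  have hYp : ∀ p ∈ e₀.source, ∀ V : ∀ x : M, TangentSpace (𝓡 n) x,
      chartField e₀ V (e₀ p) = chartComponents e₀ p (V p) := fun p hp V => by
    rw [chartField, e₀.left_inv hp]
  have hlin : ∀ p ∈ e₀.source, ∃ L : TangentSpace (𝓡 n) p ≃ₗ[ℝ] EuclideanSpace ℝ (Fin n),
      ∀ v, L v = chartComponents e₀ p v := fun p hp =>
    ⟨((mdifferentiable_of_mem_maximalAtlas he₀).mfderiv hp).toLinearEquiv, fun v => rfl⟩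
  let S : Set (EuclideanSpace ℝ (Fin n)) := e₀.target ∩ e₀.symm ⁻¹' interior (degenerationLocus X)
  have hS : IsOpen S := e₀.isOpen_inter_preimage_symm isOpen_interior
  -- Here the `d` chosen commutators remain independent. Since the rank cannot exceed `d` in the
  -- interior of the locus, they span all commutators at each point of `O`, which is `hspan` below.
  let O : Set (EuclideanSpace ℝ (Fin n)) := S ∩ (fun y i => Y i y) ⁻¹'
    {v : Fin d → EuclideanSpace ℝ (Fin n) | LinearIndependent ℝ v}
  have hO : IsOpen O := by
    refine ContinuousOn.isOpen_inter_preimage ?_ hS isOpen_setOfPred_linearIndependent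
    exact continuousOn_pi.2 fun i => (hY i).continuousOn.mono inter_subset_left
  have hp₀s : p₀ ∈ e₀.source := mem_chart_source _ p₀
  have hp₀O : e₀ p₀ ∈ O := by
    refine ⟨⟨e₀.map_source hp₀s, ?_⟩, ?_⟩
    · rwa [mem_preimage, e₀.left_inv hp₀s]
    · obtain ⟨L, hL⟩ := hlin p₀ hp₀s
      have h1 : (fun i => Y i (e₀ p₀)) = L ∘ fun i => B i p₀ := by
        funext i
        simp [Y, hYp p₀ hp₀s, hL]
      change LinearIndependent ℝ fun i => Y i (e₀ p₀)
      rw [h1]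
      exact hw.map' L.toLinearMap L.ker
  have hspan : ∀ y ∈ O, ∀ V ∈ bracketSpan X,
      chartField e₀ V y ∈ Submodule.span ℝ (range fun k => Y k y) := by
    intro y hy V hV
    have hps := e₀.map_target hy.1.1
    obtain ⟨p, hp, rfl⟩ : ∃ p ∈ e₀.source, e₀ p = y := ⟨_, hps, e₀.right_inv hy.1.1⟩
    have hpZ : p ∈ interior (degenerationLocus X) := by
      have := hy.1.2
      rwa [mem_preimage, e₀.left_inv hp] at this
    obtain ⟨L, hL⟩ := hlin p hp
    have h1 : (fun i => Y i (e₀ p)) = L ∘ fun i => B i p := by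
      funext i
      simp [Y, hYp p hp, hL]
    have h2 : LinearIndependent ℝ fun i => B i p := by
      have h3 : LinearIndependent ℝ fun i => Y i (e₀ p) := hy.2
      rw [h1] at h3
      exact LinearIndependent.of_comp L.toLinearMap h3
    have h4 : Submodule.span ℝ (range fun i => B i p) = bracketSpanAt X p := by
      refine Submodule.eq_of_le_of_finrank_le ?_ ?_
      · rw [Submodule.span_le]
        rintro _ ⟨i, rfl⟩
        exact apply_mem_bracketSpanAt (hBmem i) p
      · rw [finrank_span_eq_card h2, Fintype.card_fin]
        exact hmax p hpZ
    rw [hYp p hp, ← hL, h1, range_comp]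
    have h5 := Submodule.mem_map_of_mem (f := L.toLinearMap) (apply_mem_bracketSpanAt hV p)
    rw [← h4, Submodule.map_span] at h5
    exact h5
  obtain ⟨g, hg0, hgO, hg, hgs, hgd⟩ := exists_straightening_of_involutive hdn.le hO
    (fun i => (hY i).mono fun y hy => hy.1.1) hp₀O hp₀O.2 (fun y hy i j => by
      rw [lieBracket_chartField he₀ (hB i) (hB j) hy.1.1]
      exact hspan y hy _ (mlieBracket_mem_bracketSpan hX _ _ (hBmem j)))
  refine ⟨d, hdn, e₀.trans g, trans_mem_maximalAtlas he₀ hg hgs, ⟨p₀, ?_⟩, ?_, ?_⟩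
  · rw [OpenPartialHomeomorph.trans_source]
    exact ⟨hp₀s, hg0⟩
  · intro p hp
    rw [OpenPartialHomeomorph.trans_source] at hp
    have := (hgO hp.2).1.2
    rw [mem_preimage, e₀.left_inv hp.1] at this
    exact interior_subset this
  · intro p hp j i hi
    rw [OpenPartialHomeomorph.trans_source] at hp
    rw [chartComponents_trans he₀ hp.1
      ((hg.contDiffAt (g.open_source.mem_nhds hp.2)).differentiableAt (by simp))]
    have h1 : chartComponents e₀ p (X j p) ∈ Submodule.span ℝ (range fun k => Y k (e₀ p)) := by
      rw [← hYp p hp.1]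
      exact hspan _ (hgO hp.2) _ (Submodule.subset_span ⟨(j, []), rfl⟩)
    have h2 : Submodule.span ℝ (range fun k => Y k (e₀ p)) ≤ LinearMap.ker
        (((EuclideanSpace.proj i : EuclideanSpace ℝ (Fin n) →L[ℝ] ℝ).comp
          (fderiv ℝ g (e₀ p)) : EuclideanSpace ℝ (Fin n) →L[ℝ] ℝ) :
          EuclideanSpace ℝ (Fin n) →ₗ[ℝ] ℝ) := by
      rw [Submodule.span_le]
      rintro _ ⟨k, rfl⟩
      exact hgd _ hp.2 k i hi
    exact h2 h1

end AdaptedChart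

/-! ### Plaques of an adapted box chart as characteristic leaves. -/

section Plaques

variable {n r : ℕ} {M : Type*} [TopologicalSpace M]
  {e : OpenPartialHomeomorph M (EuclideanSpace ℝ (Fin n))}

/-- The points of the chart domain whose last `n - k` coordinates agree with those of `c`. -/
def plaque (k : ℕ) (e : OpenPartialHomeomorph M (EuclideanSpace ℝ (Fin n)))
    (c : EuclideanSpace ℝ (Fin n)) : Set M :=
  {p | p ∈ e.source ∧ ∀ i : Fin n, k ≤ (i : ℕ) → e p i = c i}

/-- The plaques of a chart. -/
def plaques (k : ℕ) (e : OpenPartialHomeomorph M (EuclideanSpace ℝ (Fin n))) : Set (Set M) :=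
  plaque k e '' e.target

/-- The chart `e` followed by the translation by `-c`. -/
noncomputable def translateChart (e : OpenPartialHomeomorph M (EuclideanSpace ℝ (Fin n)))
    (c : EuclideanSpace ℝ (Fin n)) : OpenPartialHomeomorph M (EuclideanSpace ℝ (Fin n)) :=
  e.trans (Homeomorph.addRight (-c)).toOpenPartialHomeomorph

theorem translateChart_source (c : EuclideanSpace ℝ (Fin n)) :
    (translateChart e c).source = e.source := by
  simp [translateChart]

theorem image_plaque (k : ℕ) (c : EuclideanSpace ℝ (Fin n)) :
    e '' (plaque k e c ∩ e.source) =
      {y | y ∈ e.target ∧ ∀ i : Fin n, k ≤ (i : ℕ) → y i = c i} := by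
  ext y
  constructor
  · rintro ⟨p, ⟨hp, -⟩, rfl⟩
    exact ⟨e.map_source hp.1, hp.2⟩
  · rintro ⟨hy, h⟩
    refine ⟨e.symm y, ⟨⟨e.map_target hy, ?_⟩, e.map_target hy⟩, e.right_inv hy⟩
    rwa [e.right_inv hy]

variable [ChartedSpace (EuclideanSpace ℝ (Fin n)) M] [IsManifold (𝓡 n) ∞ M]

theorem translateChart_mem_maximalAtlas (he : e ∈ IsManifold.maximalAtlas (𝓡 n) ∞ M)
    (c : EuclideanSpace ℝ (Fin n)) :
    translateChart e c ∈ IsManifold.maximalAtlas (𝓡 n) ∞ M :=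
  trans_mem_maximalAtlas he (contDiff_id.add contDiff_const).contDiffOn
    (contDiff_id.add contDiff_const).contDiffOn

theorem chartComponents_translateChart (he : e ∈ IsManifold.maximalAtlas (𝓡 n) ∞ M)
    (c : EuclideanSpace ℝ (Fin n)) {p : M} (hp : p ∈ e.source) (v : TangentSpace (𝓡 n) p) :
    chartComponents (translateChart e c) p v = chartComponents e p v := by
  have h : HasFDerivAt (Homeomorph.addRight (-c)).toOpenPartialHomeomorph
      (ContinuousLinearMap.id ℝ (EuclideanSpace ℝ (Fin n))) (e p) :=
    (hasFDerivAt_id (e p)).add_const (-c)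
  rw [translateChart, chartComponents_trans he hp h.differentiableAt, h.fderiv]
  rfl

/-- Slice charts require the last coordinates to vanish on the submanifold, whereas on a plaque they
equal those of `c`; translating by `-c` repairs this. -/
theorem isSliceChart_translateChart (he : e ∈ IsManifold.maximalAtlas (𝓡 n) ∞ M) (k : ℕ)
    (c : EuclideanSpace ℝ (Fin n)) : IsSliceChart k (plaque k e c) (translateChart e c) := by
  refine ⟨translateChart_mem_maximalAtlas he c, ?_⟩
  have h1 : (translateChart e c : M → _) = (fun y => y + -c) ∘ e := rfl
  have h2 : ∀ y, y ∈ (translateChart e c).target ↔ y + c ∈ e.target := fun y => by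
    rw [translateChart, OpenPartialHomeomorph.trans_target]
    simp [Homeomorph.addRight_symm]
  rw [translateChart_source, h1, image_comp, image_plaque]
  ext y
  rw [mem_ofPred_eq, h2]
  constructor
  · rintro ⟨z, ⟨hz, h⟩, rfl⟩
    refine ⟨by simpa using hz, fun i hi => ?_⟩
    simp [h i hi]
  · rintro ⟨hy, h⟩
    refine ⟨y + c, ⟨hy, fun i hi => ?_⟩, by simp⟩
    simp [h i hi]

theorem isSubmanifold_plaque (he : e ∈ IsManifold.maximalAtlas (𝓡 n) ∞ M) {k : ℕ} (hk : k ≤ n)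
    (c : EuclideanSpace ℝ (Fin n)) : IsSubmanifold (n := n) k (plaque k e c) :=
  ⟨hk, fun p hp => ⟨translateChart e c, by rw [translateChart_source]; exact hp.1,
    isSliceChart_translateChart he k c⟩⟩

/-- A coordinate slice of a box is convex, and the plaque is its continuous image under `e.symm`.
This is the reason for working with boxes. -/
theorem isConnected_plaque {a b : Fin n → ℝ}
    (hbox : e.target = {y | ∀ i, y i ∈ Ioo (a i) (b i)}) (k : ℕ)
    {c : EuclideanSpace ℝ (Fin n)} (hc : c ∈ e.target) : IsConnected (plaque k e c) := by
  have h1 : plaque k e c = e.symm '' {y | y ∈ e.target ∧ ∀ i : Fin n, k ≤ (i : ℕ) → y i = c i} := by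
    rw [← image_plaque]
    ext p
    constructor
    · intro hp
      exact ⟨e p, ⟨p, ⟨hp, hp.1⟩, rfl⟩, e.left_inv hp.1⟩
    · rintro ⟨_, ⟨p, ⟨hp, -⟩, rfl⟩, rfl⟩
      rwa [e.left_inv hp.1]
  have h2 : Convex ℝ {y | y ∈ e.target ∧ ∀ i : Fin n, k ≤ (i : ℕ) → y i = c i} := by
    rw [hbox]
    rintro x ⟨hx, hx'⟩ y ⟨hy, hy'⟩ s t hs ht hst
    refine ⟨fun i => ?_, fun i hi => ?_⟩
    · exact convex_Ioo (a i) (b i) (hx i) (hy i) hs ht hst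
    · simp only [PiLp.add_apply, PiLp.smul_apply, hx' i hi, hy' i hi, smul_eq_mul]
      rw [← add_mul, hst, one_mul]
  rw [h1]
  exact ⟨⟨_, c, ⟨hc, fun _ _ => rfl⟩, rfl⟩,
    h2.isPreconnected.image _ (e.continuousOn_symm.mono fun y hy => hy.1)⟩

/-- The plaques of a chart whose image is a box form a foliation. -/
theorem isFoliation_plaques (he : e ∈ IsManifold.maximalAtlas (𝓡 n) ∞ M) {a b : Fin n → ℝ}
    (hbox : e.target = {y | ∀ i, y i ∈ Ioo (a i) (b i)}) {k : ℕ} (hk : k ≤ n) :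
    IsFoliation n k e.source (plaques k e) where
  isConnected := by
    rintro _ ⟨c, hc, rfl⟩
    exact isConnected_plaque hbox k hc
  isSubmanifold := by
    rintro _ ⟨c, -, rfl⟩
    exact isSubmanifold_plaque he hk c
  pairwiseDisjoint := by
    rintro _ ⟨c, -, rfl⟩ _ ⟨c', -, rfl⟩ hne
    refine Set.disjoint_left.2 fun p hp hp' => hne ?_
    ext q
    refine and_congr_right fun _ => forall₂_congr fun i hi => ?_
    rw [← hp.2 i hi, ← hp'.2 i hi]
  sUnion_eq := by
    ext p
    constructor
    · rintro ⟨_, ⟨c, -, rfl⟩, hp⟩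
      exact hp.1
    · intro hp
      exact ⟨_, ⟨e p, e.map_source hp, rfl⟩, hp, fun _ _ => rfl⟩
  exists_flatChart := fun p hp => ⟨e, hp, subset_rfl, he, ⟨a, b, hbox⟩, by
    rintro _ ⟨c, -, rfl⟩
    refine ⟨{c}, countable_singleton c, ?_⟩
    rw [image_plaque]
    simp⟩

/-- Translations have identity differential, so the vanishing of the transverse components in `e`
passes to the slice chart of each plaque. -/
theorem isCharacteristicSubmanifold_plaque {X : Fin r → ∀ x : M, TangentSpace (𝓡 n) x}
    (he : e ∈ IsManifold.maximalAtlas (𝓡 n) ∞ M) {k : ℕ} (hk : k < n)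
    (hX : ∀ p ∈ e.source, ∀ j, ∀ i : Fin n, k ≤ (i : ℕ) → chartComponents e p (X j p) i = 0)
    {c : EuclideanSpace ℝ (Fin n)} (hc : c ∈ e.target) :
    IsCharacteristicSubmanifold X k (plaque k e c) where
  nonempty := ⟨e.symm c, e.map_target hc, fun i _ => by rw [e.right_inv hc]⟩
  lt_dim := hk
  isSubmanifold := isSubmanifold_plaque he hk.le c
  tangent := fun p hp j => ⟨translateChart e c, by rw [translateChart_source]; exact hp.1,
    isSliceChart_translateChart he k c, fun i hi => by
      rw [chartComponents_translateChart he c hp.1]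
      exact hX p hp.1 j i hi⟩

theorem exists_box_subset {s : Set (EuclideanSpace ℝ (Fin n))} (hs : IsOpen s)
    {y : EuclideanSpace ℝ (Fin n)} (hy : y ∈ s) : ∃ a b : Fin n → ℝ,
      (∀ i, y i ∈ Ioo (a i) (b i)) ∧ {z : EuclideanSpace ℝ (Fin n) | ∀ i, z i ∈ Ioo (a i) (b i)} ⊆ s := by
  have h1 : IsOpen ((WithLp.toLp 2 : (Fin n → ℝ) → EuclideanSpace ℝ (Fin n)) ⁻¹' s) :=
    hs.preimage (PiLp.continuous_toLp 2 _)
  obtain ⟨ε, hε, hsub⟩ := Metric.isOpen_iff.1 h1 (WithLp.ofLp y) hy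
  refine ⟨fun i => y i - ε, fun i => y i + ε, fun i => ⟨by linarith, by linarith⟩, fun z hz => ?_⟩
  have : WithLp.ofLp z ∈ Metric.ball (WithLp.ofLp y) ε := by
    rw [Metric.mem_ball, dist_pi_lt_iff hε]
    intro i
    rw [← Metric.mem_ball, Real.ball_eq_Ioo]
    exact hz i
  exact hsub this

/-- In the interior of the degeneration locus there is an adapted chart whose image is a box. -/
theorem exists_adapted_box_chart {X : Fin r → ∀ x : M, TangentSpace (𝓡 n) x}
    (hX : ∀ j, IsSmoothVectorField (X j)) (hZ : (interior (degenerationLocus X)).Nonempty) :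
    ∃ d < n, ∃ e ∈ IsManifold.maximalAtlas (𝓡 n) ∞ M, e.source.Nonempty ∧
      e.source ⊆ degenerationLocus X ∧
      (∃ a b : Fin n → ℝ, e.target = {y | ∀ i, y i ∈ Ioo (a i) (b i)}) ∧
      ∀ p ∈ e.source, ∀ j, ∀ i : Fin n, d ≤ (i : ℕ) → chartComponents e p (X j p) i = 0 := by
  obtain ⟨d, hd, e, he, ⟨p, hp⟩, heZ, heX⟩ := exists_adapted_chart hX hZ
  obtain ⟨a, b, hab, hsub⟩ := exists_box_subset e.open_target (e.map_source hp)
  have hopen : IsOpen {z : EuclideanSpace ℝ (Fin n) | ∀ i, z i ∈ Ioo (a i) (b i)} := by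
    have : {z : EuclideanSpace ℝ (Fin n) | ∀ i, z i ∈ Ioo (a i) (b i)} =
        ⋂ i, (fun z : EuclideanSpace ℝ (Fin n) => z i) ⁻¹' Ioo (a i) (b i) := by
      ext z; simp
    rw [this]
    exact isOpen_iInter_of_finite fun i => isOpen_Ioo.preimage (by fun_prop)
  let g := OpenPartialHomeomorph.ofSet _ hopen
  have hsrc : ∀ q, q ∈ (e.trans g).source ↔ q ∈ e.source ∧ ∀ i, e q i ∈ Ioo (a i) (b i) :=
    fun q => by simp [g]
  refine ⟨d, hd, e.trans g, trans_mem_maximalAtlas he contDiff_id.contDiffOn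
    contDiff_id.contDiffOn, ⟨p, (hsrc p).2 ⟨hp, hab⟩⟩, fun q hq => heZ ((hsrc q).1 hq).1,
    ⟨a, b, ?_⟩, fun q hq j i hi => ?_⟩
  · rw [OpenPartialHomeomorph.trans_target]
    exact inter_eq_left.2 hsub
  · have hq' := ((hsrc q).1 hq).1
    have h : HasFDerivAt g (ContinuousLinearMap.id ℝ (EuclideanSpace ℝ (Fin n))) (e q) :=
      hasFDerivAt_id (e q)
    rw [chartComponents_trans he hq' h.differentiableAt, h.fderiv]
    exact heX q hq' j i hi

end Plaques

/-! ### Smooth volumes in charts. -/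

section Volume

variable {n : ℕ} {M : Type*} [TopologicalSpace M] [ChartedSpace (EuclideanSpace ℝ (Fin n)) M]
  [MeasurableSpace M] [BorelSpace M] {m : Measure M}
  {e : OpenPartialHomeomorph M (EuclideanSpace ℝ (Fin n))}

theorem aemeasurable_chart (e : OpenPartialHomeomorph M (EuclideanSpace ℝ (Fin n)))
    (m : Measure M) : AEMeasurable e (m.restrict e.source) :=
  e.continuousOn.aemeasurable e.open_source.measurableSet

/-- A continuous density is bounded on a closed ball inside the chart. On compact `M` this makes the
volume finite. -/
theorem IsSmoothVolume.isLocallyFiniteMeasure [IsManifold (𝓡 n) ∞ M] (hm : IsSmoothVolume n m) :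
    IsLocallyFiniteMeasure m := by
  refine ⟨fun p => ?_⟩
  let e := chartAt (EuclideanSpace ℝ (Fin n)) p
  have hp : p ∈ e.source := mem_chart_source _ p
  obtain ⟨ρ, hρ, -, hmap⟩ := hm e (IsManifold.chart_mem_maximalAtlas p)
  obtain ⟨ε, hε, hsub⟩ := Metric.nhds_basis_closedBall.mem_iff.1
    (e.open_target.mem_nhds (e.map_source hp))
  obtain ⟨C, hC⟩ := (isCompact_closedBall (e p) ε).exists_bound_of_continuousOn
    (hρ.continuousOn.mono hsub)
  refine ⟨e.source ∩ e ⁻¹' Metric.ball (e p) ε,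
    (e.isOpen_inter_preimage Metric.isOpen_ball).mem_nhds ⟨hp, Metric.mem_ball_self hε⟩, ?_⟩
  have h1 : m (e.source ∩ e ⁻¹' Metric.ball (e p) ε) ≤
      (m.restrict e.source) (e ⁻¹' Metric.ball (e p) ε) := by
    rw [inter_comm]
    exact Measure.le_restrict_apply _ _
  refine (h1.trans (Measure.le_map_apply (aemeasurable_chart e m) _)).trans_lt ?_
  rw [hmap, withDensity_apply _ Metric.isOpen_ball.measurableSet]
  calc ∫⁻ y in Metric.ball (e p) ε, ENNReal.ofReal (ρ y) ∂(volume.restrict e.target)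
      ≤ ∫⁻ y in Metric.ball (e p) ε, ENNReal.ofReal C ∂(volume.restrict e.target) := by
        refine setLIntegral_mono' Metric.isOpen_ball.measurableSet fun y hy => ?_
        exact ENNReal.ofReal_le_ofReal
          ((le_abs_self _).trans (hC y (Metric.ball_subset_closedBall hy)))
    _ = ENNReal.ofReal C * (volume.restrict e.target) (Metric.ball (e p) ε) := by
        rw [setLIntegral_const]
    _ < ⊤ := ENNReal.mul_lt_top ENNReal.ofReal_lt_top
        ((Measure.restrict_apply_le _ _).trans_lt measure_ball_lt_top)

/-- Null sets for a smooth volume are null sets in the charts. -/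
theorem IsSmoothVolume.ae_symm (hm : IsSmoothVolume n m)
    (he : e ∈ IsManifold.maximalAtlas (𝓡 n) ∞ M) {P : M → Prop} (hP : ∀ᵐ p ∂m, P p) :
    ∀ᵐ y ∂volume.restrict e.target, P (e.symm y) := by
  obtain ⟨ρ, hρ, hρ0, hmap⟩ := hm e he
  let N := toMeasurable m {p | ¬ P p}
  have hN : m N = 0 := by rw [measure_toMeasurable]; exact hP
  let S := e.target ∩ e.symm ⁻¹' N
  have hS : MeasurableSet S := by
    have h := e.open_target.measurableSet.subtype_image
      ((continuousOn_iff_continuous_domRestrict.1 e.continuousOn_symm).measurable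
        (measurableSet_toMeasurable m {p | ¬ P p}))
    convert h using 1
    ext y
    simpa [S, N] using and_comm
  have h1 : (m.restrict e.source).map e S = 0 := by
    rw [Measure.map_apply_of_aemeasurable (aemeasurable_chart e m) hS,
      Measure.restrict_apply' e.open_source.measurableSet]
    refine measure_mono_null ?_ hN
    rintro p ⟨hp, hps⟩
    have := hp.2
    rwa [mem_preimage, e.left_inv hps] at this
  rw [hmap] at h1
  -- Positivity of the density is what makes Lebesgue measure absolutely continuous with respect to
  -- the pushed-forward volume.
  have hac : volume.restrict e.target ≪
      (volume.restrict e.target).withDensity fun y => ENNReal.ofReal (ρ y) := by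
    refine withDensity_absolutelyContinuous' ?_ ?_
    · exact (hρ.continuousOn.aemeasurable e.open_target.measurableSet).ennreal_ofReal
    · filter_upwards [ae_restrict_mem e.open_target.measurableSet] with y hy
      simpa using hρ0 y hy
  have h2 : ∀ᵐ y ∂volume.restrict e.target, y ∉ S := measure_eq_zero_iff_ae_notMem.1 (hac h1)
  filter_upwards [h2, ae_restrict_mem e.open_target.measurableSet] with y hy hyt
  by_contra h
  exact hy ⟨hyt, subset_toMeasurable _ _ h⟩

/-- Integration in a chart. -/
theorem IsSmoothVolume.exists_integral_eq (hm : IsSmoothVolume n m)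
    (he : e ∈ IsManifold.maximalAtlas (𝓡 n) ∞ M) :
    ∃ ρ : EuclideanSpace ℝ (Fin n) → ℝ, ContinuousOn ρ e.target ∧
      ∀ F : M → ℝ, (∀ p, p ∉ e.source → F p = 0) → ContinuousOn F e.source →
        ∫ p, F p ∂m = ∫ y in e.target, ρ y * F (e.symm y) := by
  obtain ⟨ρ, hρ, hρ0, hmap⟩ := hm e he
  refine ⟨ρ, hρ.continuousOn, fun F hF0 hF => ?_⟩
  have hmeas : AEMeasurable (fun y => ENNReal.ofReal (ρ y)) (volume.restrict e.target) :=
    (hρ.continuousOn.aemeasurable e.open_target.measurableSet).ennreal_ofReal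
  have hc : ContinuousOn (fun y => F (e.symm y)) e.target :=
    hF.comp e.continuousOn_symm fun y hy => e.map_target hy
  rw [← setIntegral_eq_integral_of_forall_compl_eq_zero hF0]
  have h1 : ∫ p in e.source, F p ∂m = ∫ p in e.source, F (e.symm (e p)) ∂m :=
    setIntegral_congr_fun e.open_source.measurableSet fun p hp => by
      simp only [e.left_inv hp]
  have h2 : AEStronglyMeasurable (fun y => F (e.symm y)) ((m.restrict e.source).map e) := by
    rw [hmap]
    exact (hc.aestronglyMeasurable e.open_target.measurableSet).mono_ac
      (withDensity_absolutelyContinuous _ _)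
  rw [h1, ← integral_map (aemeasurable_chart e m) h2, hmap,
    integral_withDensity_eq_integral_toReal_smul₀ hmeas (by simp)]
  refine setIntegral_congr_fun e.open_target.measurableSet fun y hy => ?_
  simp [ENNReal.toReal_ofReal (hρ0 y hy).le]

end Volume

/-! ### Derivatives of functions along vector fields. -/

section Derivative

variable {n : ℕ} {M : Type*} [TopologicalSpace M] [ChartedSpace (EuclideanSpace ℝ (Fin n)) M]
  {e : OpenPartialHomeomorph M (EuclideanSpace ℝ (Fin n))}

/-- The derivative of a function along a vector field. -/
noncomputable def fieldDeriv (V : ∀ x : M, TangentSpace (𝓡 n) x) (F : M → ℝ) (p : M) : ℝ :=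
  mfderiv (𝓡 n) 𝓘(ℝ, ℝ) F p (V p)

theorem contDiffOn_comp_symm {F : M → ℝ} (he : e ∈ IsManifold.maximalAtlas (𝓡 n) ∞ M)
    (hF : ContMDiff (𝓡 n) 𝓘(ℝ, ℝ) ∞ F) : ContDiffOn ℝ ∞ (fun y => F (e.symm y)) e.target :=
  contMDiffOn_iff_contDiffOn.1 (hF.comp_contMDiffOn (contMDiffOn_symm_of_mem_maximalAtlas he))

variable [IsManifold (𝓡 n) ∞ M]

theorem fieldDeriv_eq (he : e ∈ IsManifold.maximalAtlas (𝓡 n) ∞ M)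
    (V : ∀ x : M, TangentSpace (𝓡 n) x) {F : M → ℝ} (hF : ContMDiff (𝓡 n) 𝓘(ℝ, ℝ) ∞ F)
    {p : M} (hp : p ∈ e.source) :
    fieldDeriv V F p = fderiv ℝ (fun z => F (e.symm z)) (e p) (chartComponents e p (V p)) := by
  have h1 : HasFDerivAt (fun z => F (e.symm z)) (fderiv ℝ (fun z => F (e.symm z)) (e p)) (e p) :=
    (((contDiffOn_comp_symm he hF).contDiffAt
      (e.open_target.mem_nhds (e.map_source hp))).differentiableAt (by simp)).hasFDerivAt
  have h2 := h1.hasMFDerivAt.comp p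
    ((mdifferentiable_of_mem_maximalAtlas he).mdifferentiableAt hp).hasMFDerivAt
  have h3 : F =ᶠ[𝓝 p] (fun z => F (e.symm z)) ∘ e := by
    filter_upwards [e.open_source.mem_nhds hp] with q hq
    simp [e.left_inv hq]
  have h4 := (h2.congr_of_eventuallyEq h3).mfderiv
  rw [fieldDeriv, h4]
  rfl

theorem fieldDeriv_symm (he : e ∈ IsManifold.maximalAtlas (𝓡 n) ∞ M)
    (V : ∀ x : M, TangentSpace (𝓡 n) x) {F : M → ℝ} (hF : ContMDiff (𝓡 n) 𝓘(ℝ, ℝ) ∞ F)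
    {y : EuclideanSpace ℝ (Fin n)} (hy : y ∈ e.target) :
    fieldDeriv V F (e.symm y) = fderiv ℝ (fun z => F (e.symm z)) y (chartField e V y) := by
  rw [fieldDeriv_eq he V hF (e.map_target hy), e.right_inv hy]
  rfl

theorem continuous_fieldDeriv {V : ∀ x : M, TangentSpace (𝓡 n) x} (hV : IsSmoothVectorField V)
    {F : M → ℝ} (hF : ContMDiff (𝓡 n) 𝓘(ℝ, ℝ) ∞ F) : Continuous (fieldDeriv V F) := by
  refine continuous_iff_continuousAt.2 fun p => ?_
  let e := chartAt (EuclideanSpace ℝ (Fin n)) p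
  have he : e ∈ IsManifold.maximalAtlas (𝓡 n) ∞ M := IsManifold.chart_mem_maximalAtlas p
  have hp : p ∈ e.source := mem_chart_source _ p
  have h1 : ContinuousOn (fun y => fderiv ℝ (fun z => F (e.symm z)) y (chartField e V y)) e.target :=
    ((contDiffOn_comp_symm he hF).continuousOn_fderiv_of_isOpen e.open_target (by simp)).clm_apply
      (contDiffOn_chartField he hV).continuousOn
  have h2 : ContinuousOn (fieldDeriv V F) e.source := by
    refine (h1.comp e.continuousOn fun q hq => e.map_source hq).congr fun q hq => ?_
    have := fieldDeriv_symm he V hF (e.map_source hq)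
    rwa [e.left_inv hq] at this
  exact h2.continuousAt (e.open_source.mem_nhds hp)

end Derivative

/-! ### Classical and distributional derivatives; smooth members of the Dirichlet ball. -/

section IntegrationByParts

/-- Integration by parts against the divergence of a compactly supported vector field, for a
function which is smooth on an open set containing the support. -/
theorem integral_mul_fderiv_apply_eq_neg {n : ℕ} {s : Set (EuclideanSpace ℝ (Fin n))}
    (hs : IsOpen s) {φ : EuclideanSpace ℝ (Fin n) → ℝ} (hφ : ContDiff ℝ ∞ φ)
    (hφc : HasCompactSupport φ) (hφs : tsupport φ ⊆ s)
    {b : EuclideanSpace ℝ (Fin n) → EuclideanSpace ℝ (Fin n)} (hb : ContDiffOn ℝ ∞ b s)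
    {u : EuclideanSpace ℝ (Fin n) → ℝ} (hu : ContDiffOn ℝ ∞ u s) :
    ∫ y in s, φ y * fderiv ℝ u y (b y) =
      -∫ y in s, (∑ i, fderiv ℝ (fun z => φ z * b z i) y (EuclideanSpace.single i 1)) * u y := by
  let ψ : Fin n → EuclideanSpace ℝ (Fin n) → ℝ := fun i z => φ z * b z i
  have hbi : ∀ i, ContDiffOn ℝ ∞ (fun z => b z i) s := fun i =>
    (EuclideanSpace.proj i : EuclideanSpace ℝ (Fin n) →L[ℝ] ℝ).contDiff.comp_contDiffOn hb
  have hψsupp : ∀ i, tsupport (ψ i) ⊆ tsupport φ := fun i =>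
    tsupport_mul_subset_left
  -- Although `b` is smooth only on `s`, the product is smooth everywhere because its support lies
  -- in that of `φ`.
  have hψ : ∀ i, ContDiff ℝ ∞ (ψ i) := fun i =>
    contMDiff_iff_contDiff.1 (contMDiff_of_tsupport fun z hz => by
      have hz' := hφs (hψsupp i hz)
      exact ContDiffAt.contMDiffAt
        (hφ.contDiffAt.mul ((hbi i).contDiffAt (hs.mem_nhds hz'))))
  have hu1 : ContinuousOn (fderiv ℝ u) s := hu.continuousOn_fderiv_of_isOpen hs (by simp)
  have hint : ∀ f g : EuclideanSpace ℝ (Fin n) → ℝ, Continuous f → ContinuousOn g s →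
      tsupport f ⊆ tsupport φ → Integrable (fun x => f x * g x) := by
    intro f g hf hg hfs
    have h1 : IntegrableOn (fun x => f x * g x) (tsupport φ) :=
      (hf.continuousOn.mul (hg.mono hφs)).integrableOn_compact hφc
    refine (integrableOn_iff_integrable_of_support_subset ?_).1 h1
    exact (Function.support_mul_subset_left _ _).trans ((subset_tsupport f).trans hfs)
  have hparts : ∀ i, ∫ y, ψ i y * fderiv ℝ u y (EuclideanSpace.single i 1) =
      -∫ y, fderiv ℝ (ψ i) y (EuclideanSpace.single i 1) * u y := by
    intro i
    have hd : Continuous fun x => fderiv ℝ (ψ i) x (EuclideanSpace.single i 1) :=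
      ((hψ i).continuous_fderiv (by simp)).clm_apply continuous_const
    have hds : tsupport (fun x => fderiv ℝ (ψ i) x (EuclideanSpace.single i 1)) ⊆ tsupport φ :=
      (tsupport_fderiv_apply_subset ℝ _).trans (hψsupp i)
    refine integral_mul_fderiv_eq_neg_fderiv_mul_of_integrable (hint _ _ hd hu.continuousOn hds)
      (hint _ _ (hψ i).continuous (hu1.clm_apply continuousOn_const) (hψsupp i))
      (hint _ _ (hψ i).continuous hu.continuousOn (hψsupp i))
      (fun x _ => (hψ i).differentiable (by simp) x) fun x hx => ?_
    exact (hu.contDiffAt (hs.mem_nhds (hφs (hψsupp i hx)))).differentiableAt (by simp)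
  have hout : ∀ y, y ∉ s → φ y = 0 := fun y hy =>
    image_eq_zero_of_notMem_tsupport fun h => hy (hφs h)
  have hsum : ∀ y, φ y * fderiv ℝ u y (b y) =
      ∑ i, ψ i y * fderiv ℝ u y (EuclideanSpace.single i 1) := by
    intro y
    have : b y = ∑ i, b y i • EuclideanSpace.single i (1 : ℝ) := by
      ext j
      simp [Finset.sum_apply, Pi.single_apply]
    conv_lhs => rw [this]
    simp only [map_sum, map_smul, Finset.mul_sum, smul_eq_mul, ψ, mul_assoc]
  rw [setIntegral_eq_integral_of_forall_compl_eq_zero fun y hy => by rw [hout y hy, zero_mul],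
    setIntegral_eq_integral_of_forall_compl_eq_zero fun y hy => by
      rw [Finset.sum_eq_zero, zero_mul]
      intro i _
      have h1 : y ∉ tsupport (ψ i) := fun h => hy (hφs (hψsupp i h))
      exact image_eq_zero_of_notMem_tsupport
        (f := fun x => fderiv ℝ (ψ i) x (EuclideanSpace.single i 1))
        fun h => h1 (tsupport_fderiv_apply_subset ℝ _ h)]
  simp only [hsum, Finset.sum_mul]
  rw [integral_finsetSum, integral_finsetSum, ← Finset.sum_neg_distrib]
  · exact Finset.sum_congr rfl fun i _ => hparts i
  · intro i _
    refine hint _ _ ?_ hu.continuousOn ((tsupport_fderiv_apply_subset ℝ _).trans (hψsupp i))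
    exact ((hψ i).continuous_fderiv (by simp)).clm_apply continuous_const
  · intro i _
    exact hint _ _ (hψ i).continuous (hu1.clm_apply continuousOn_const) (hψsupp i)

variable {n r : ℕ} {M : Type*} [TopologicalSpace M] [ChartedSpace (EuclideanSpace ℝ (Fin n)) M]
  [IsManifold (𝓡 n) ∞ M] [MeasurableSpace M] [BorelSpace M] {m : Measure M}
  {𝕜 : Type*} [RCLike 𝕜]

/-- The classical derivative of a smooth function is its distributional derivative. -/
theorem isDistributionalDerivative_fieldDeriv (hm : IsSmoothVolume n m)
    {V : ∀ x : M, TangentSpace (𝓡 n) x} (hV : IsSmoothVectorField V) {F : M → ℝ}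
    (hF : ContMDiff (𝓡 n) 𝓘(ℝ, ℝ) ∞ F) {f g : M → 𝕜} (hf : ∀ᵐ p ∂m, f p = (F p : 𝕜))
    (hg : ∀ᵐ p ∂m, g p = (fieldDeriv V F p : 𝕜)) : IsDistributionalDerivative V f g := by
  intro e he φ hφ hφc hφs
  have h1 : ∫ y in e.target, φ y • g (e.symm y) =
      ((∫ y in e.target, φ y * fderiv ℝ (fun z => F (e.symm z)) y (chartField e V y) : ℝ) : 𝕜) := by
    rw [← integral_ofReal]
    refine integral_congr_ae ?_
    filter_upwards [hm.ae_symm he hg, ae_restrict_mem e.open_target.measurableSet] with y hy hyt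
    rw [hy, fieldDeriv_symm he V hF hyt, RCLike.real_smul_eq_coe_mul, RCLike.ofReal_mul]
  have h2 : ∫ y in e.target, (∑ i : Fin n, fderiv ℝ
      (fun z => φ z * chartComponents e (e.symm z) (V (e.symm z)) i) y
        (EuclideanSpace.single i 1)) • f (e.symm y) =
      ((∫ y in e.target, (∑ i, fderiv ℝ (fun z => φ z * chartField e V z i) y
        (EuclideanSpace.single i 1)) * F (e.symm y) : ℝ) : 𝕜) := by
    rw [← integral_ofReal]
    refine integral_congr_ae ?_
    filter_upwards [hm.ae_symm he hf] with y hy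
    rw [hy, RCLike.real_smul_eq_coe_mul, RCLike.ofReal_mul]
    rfl
  rw [h1, h2, integral_mul_fderiv_apply_eq_neg e.open_target hφ hφc hφs
    (contDiffOn_chartField he hV) (contDiffOn_comp_symm he hF), RCLike.ofReal_neg]

theorem memLp_ofReal_of_continuous [IsFiniteMeasure m] {F : M → ℝ} (hF : Continuous F) {C : ℝ}
    (hC : ∀ p, |F p| ≤ C) : MemLp (fun p => (F p : 𝕜)) 2 m :=
  MemLp.of_bound (RCLike.continuous_ofReal.comp hF).aestronglyMeasurable C
    (Eventually.of_forall fun p => by simpa using hC p)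

/-- Smooth functions with small derivatives along the `X j` are in the Dirichlet ball. -/
theorem exists_toLp_mem_dirichletBall [IsFiniteMeasure m] (hm : IsSmoothVolume n m)
    {X : Fin r → ∀ x : M, TangentSpace (𝓡 n) x} (hX : ∀ j, IsSmoothVectorField (X j)) :
    ∃ δ > 0, ∀ (F : M → ℝ) (_ : ContMDiff (𝓡 n) 𝓘(ℝ, ℝ) ∞ F) (_ : ∀ p, |F p| ≤ δ)
      (_ : ∀ j p, |fieldDeriv (X j) F p| ≤ δ) (hF : MemLp (fun p => (F p : 𝕜)) 2 m),
      hF.toLp _ ∈ dirichletBall 𝕜 m X := by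
  -- The constant `c` is the square root of the total volume, so a sup bound `δ` gives an `L²` norm
  -- of at most `c δ`. The `r + 1` terms of the energy then call for `(r + 1) (c δ)² ≤ 1`; using `c
  -- + 1` avoids dividing by zero.
  set c : ℝ := (measureUnivNNReal m : ℝ) ^ (ENNReal.toReal 2)⁻¹ with hc
  have hc0 : 0 ≤ c := by positivity
  refine ⟨1 / ((r + 1) * (c + 1)), by positivity, fun F hF hF1 hF2 hFL => ?_⟩
  set δ : ℝ := 1 / ((r + 1) * (c + 1)) with hδ
  have hδ0 : 0 < δ := by positivity
  have hg : ∀ j, MemLp (fun p => (fieldDeriv (X j) F p : 𝕜)) 2 m := fun j =>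
    memLp_ofReal_of_continuous (continuous_fieldDeriv (hX j) hF) (hF2 j)
  have hnorm : ∀ (G : M → ℝ) (_ : ∀ p, |G p| ≤ δ) (hG : MemLp (fun p => (G p : 𝕜)) 2 m),
      ‖hG.toLp _‖ ^ 2 ≤ (c * δ) ^ 2 := by
    intro G hG1 hG
    have := Lp.norm_le_of_ae_bound (f := hG.toLp _) (C := δ) hδ0.le (by
      filter_upwards [hG.coeFn_toLp] with p hp
      rw [hp]
      simpa using hG1 p)
    gcongr
  refine ⟨fun j => (hg j).toLp _, fun j => ?_, ?_⟩
  · exact isDistributionalDerivative_fieldDeriv hm (hX j) hF hFL.coeFn_toLp (hg j).coeFn_toLp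
  · have h1 : ∑ j, ‖(hg j).toLp _‖ ^ 2 ≤ r * (c * δ) ^ 2 := by
      refine (Finset.sum_le_sum fun j _ => hnorm _ (hF2 j) (hg j)).trans ?_
      simp
    have h2 := hnorm F hF1 hFL
    have h3 : (r + 1) * (c * δ) ^ 2 ≤ 1 := by
      rw [hδ]
      rw [mul_one_div, div_pow, mul_div_assoc', div_le_one (by positivity)]
      have hr : (0 : ℝ) ≤ r := by positivity
      calc ((r : ℝ) + 1) * c ^ 2 ≤ (r + 1) ^ 2 * (c + 1) ^ 2 := by
            gcongr
            · nlinarith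
            · linarith
        _ = ((r + 1) * (c + 1)) ^ 2 := by ring
    linarith

end IntegrationByParts

/-! ### Localized waves in a transverse coordinate. -/

section Oscillation

/-- The Riemann-Lebesgue lemma for oscillations in a coordinate direction. -/
theorem tendsto_integral_mul_cos {n : ℕ} (i : Fin n) {h : EuclideanSpace ℝ (Fin n) → ℝ}
    (hh : Integrable h) :
    Tendsto (fun t : ℝ => ∫ y, h y * Real.cos (t * y i)) atTop (𝓝 0) := by
  have h1 := tendsto_integral_exp_inner_smul_cocompact (fun y => (h y : ℂ))
  -- The Fourier character carries a factor `2π`, so this frequency has `cos (t y i)` as the real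
  -- part of its wave.
  have h2 : Tendsto (fun t : ℝ => (t / (2 * Real.pi)) • EuclideanSpace.single i (1 : ℝ)) atTop
      (cocompact (EuclideanSpace ℝ (Fin n))) := by
    rw [← Metric.cobounded_eq_cocompact, ← tendsto_norm_atTop_iff_cobounded]
    simp only [norm_smul, PiLp.norm_single, norm_one, mul_one]
    exact tendsto_norm_atTop_atTop.comp (tendsto_id.atTop_div_const (by positivity))
  have h3 := (Complex.continuous_re.tendsto _).comp (h1.comp h2)
  rw [Complex.zero_re] at h3
  refine h3.congr fun t => ?_
  simp only [Function.comp_apply]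
  have hh' : Integrable fun y => (h y : ℂ) := hh.ofReal
  have h4 := (Real.fourierIntegral_convergent_iff
    ((t / (2 * Real.pi)) • EuclideanSpace.single i (1 : ℝ))).2 hh'
  have h5 := integral_re h4
  refine Eq.trans h5.symm (integral_congr_ae (Eventually.of_forall fun y => ?_))
  have h6 : 2 * Real.pi * -inner ℝ y ((t / (2 * Real.pi)) • EuclideanSpace.single i (1 : ℝ)) =
      -(t * y i) := by
    rw [inner_smul_right, EuclideanSpace.inner_single_right]
    simp
    field_simp
  simp only [Circle.smul_def, Real.fourierChar_apply, h6, smul_eq_mul]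
  rw [RCLike.re_eq_complex_re, Complex.re_mul_ofReal, Complex.exp_ofReal_mul_I_re, Real.cos_neg,
    mul_comm]

variable {n : ℕ} {M : Type*} [TopologicalSpace M] [ChartedSpace (EuclideanSpace ℝ (Fin n)) M]
  {e : OpenPartialHomeomorph M (EuclideanSpace ℝ (Fin n))}

/-- A cutoff function times a wave in the `i`-th coordinate of a chart. -/
noncomputable def oscillation (χ : M → ℝ)
    (e : OpenPartialHomeomorph M (EuclideanSpace ℝ (Fin n))) (i : Fin n) (t : ℝ) (p : M) : ℝ :=
  χ p * Real.cos (t * e p i)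

theorem contMDiff_oscillation (he : e ∈ IsManifold.maximalAtlas (𝓡 n) ∞ M) {χ : M → ℝ}
    (hχ : ContMDiff (𝓡 n) 𝓘(ℝ, ℝ) ∞ χ) (hχs : tsupport χ ⊆ e.source) (i : Fin n) (t : ℝ) :
    ContMDiff (𝓡 n) 𝓘(ℝ, ℝ) ∞ (oscillation χ e i t) := by
  refine contMDiff_of_tsupport fun p hp => ?_
  have hps := hχs (tsupport_mul_subset_left hp)
  have h1 : ContDiff ℝ ∞ (fun y : EuclideanSpace ℝ (Fin n) => Real.cos (t * y i)) :=
    Real.contDiff_cos.comp (contDiff_const.mul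
      (EuclideanSpace.proj i : EuclideanSpace ℝ (Fin n) →L[ℝ] ℝ).contDiff)
  have h2 : ContMDiffAt (𝓡 n) 𝓘(ℝ, ℝ) ∞ (fun p => Real.cos (t * e p i)) p :=
    h1.contMDiff.contMDiffAt.comp p (contMDiffAt_of_mem_maximalAtlas he hps)
  exact hχ.contMDiffAt.mul h2

/-- Along a field without component in the `i`-th coordinate, only the cutoff is differentiated. -/
theorem fieldDeriv_oscillation [IsManifold (𝓡 n) ∞ M] (he : e ∈ IsManifold.maximalAtlas (𝓡 n) ∞ M) {χ : M → ℝ}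
    (hχ : ContMDiff (𝓡 n) 𝓘(ℝ, ℝ) ∞ χ) (hχs : tsupport χ ⊆ e.source) (i : Fin n) (t : ℝ)
    {V : ∀ x : M, TangentSpace (𝓡 n) x} (hV : ∀ p ∈ e.source, chartComponents e p (V p) i = 0)
    (p : M) : |fieldDeriv V (oscillation χ e i t) p| ≤ |fieldDeriv V χ p| := by
  by_cases hp : p ∈ e.source
  · have hosc := contMDiff_oscillation he hχ hχs i t
    set v := chartComponents e p (V p) with hv
    have h1 : HasFDerivAt (fun z => χ (e.symm z)) (fderiv ℝ (fun z => χ (e.symm z)) (e p)) (e p) :=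
      (((contDiffOn_comp_symm he hχ).contDiffAt
        (e.open_target.mem_nhds (e.map_source hp))).differentiableAt (by simp)).hasFDerivAt
    have h2 : HasFDerivAt (fun z : EuclideanSpace ℝ (Fin n) => Real.cos (t * z i))
        (-Real.sin (t * e p i) • (t • (EuclideanSpace.proj i : EuclideanSpace ℝ (Fin n) →L[ℝ] ℝ)))
        (e p) :=
      ((EuclideanSpace.proj i : EuclideanSpace ℝ (Fin n) →L[ℝ] ℝ).hasFDerivAt.const_mul t).cos
    have h3 : (fun z => oscillation χ e i t (e.symm z)) =ᶠ[𝓝 (e p)]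
        fun z => χ (e.symm z) * Real.cos (t * z i) := by
      filter_upwards [e.open_target.mem_nhds (e.map_source hp)] with z hz
      rw [oscillation, e.right_inv hz]
    rw [fieldDeriv_eq he V hosc hp, fieldDeriv_eq he V hχ hp, h3.fderiv_eq]
    have h5 : HasFDerivAt (fun z => χ (e.symm z) * Real.cos (t * z i)) _ (e p) := h1.mul h2
    rw [h5.fderiv]
    -- The only term with the large factor `t` also has the factor `v i`, which is zero; the bound
    -- is therefore independent of the frequency.
    change |χ _ * (-Real.sin _ * (t * v i)) + Real.cos _ * fderiv ℝ _ _ v| ≤ _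
    rw [hv, hV p hp, mul_zero, mul_zero, mul_zero, zero_add, abs_mul]
    exact mul_le_of_le_one_left (abs_nonneg _) (Real.abs_cos_le_one _)
  · have h1 : oscillation χ e i t =ᶠ[𝓝 p] fun _ => 0 := by
      have : (tsupport χ)ᶜ ∈ 𝓝 p :=
        (isClosed_tsupport χ).isOpen_compl.mem_nhds fun h => hp (hχs h)
      filter_upwards [this] with q hq
      rw [oscillation, image_eq_zero_of_notMem_tsupport hq, zero_mul]
    have h2 : fieldDeriv V (oscillation χ e i t) p = 0 := by
      rw [fieldDeriv, ((hasMFDerivAt_const (0 : ℝ) p).congr_of_eventuallyEq h1).mfderiv]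
      rfl
    rw [h2, abs_zero]
    exact abs_nonneg _

variable [MeasurableSpace M] [BorelSpace M] {m : Measure M}

/-- In the chart the integral is that of a fixed integrable function, the cutoff times the density,
against `cos (t y i)`, so the Riemann-Lebesgue lemma applies. -/
theorem tendsto_integral_oscillation [CompactSpace M] (hm : IsSmoothVolume n m)
    (he : e ∈ IsManifold.maximalAtlas (𝓡 n) ∞ M) {χ : M → ℝ} (hχ : Continuous χ)
    (hχs : tsupport χ ⊆ e.source) (i : Fin n) :
    Tendsto (fun t : ℝ => ∫ p, oscillation χ e i t p ∂m) atTop (𝓝 0) := by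
  obtain ⟨ρ, hρc, hρ⟩ := hm.exists_integral_eq he
  have hK : IsCompact (e '' tsupport χ) :=
    (isClosed_tsupport χ).isCompact.image_of_continuousOn (e.continuousOn.mono hχs)
  have hKt : e '' tsupport χ ⊆ e.target := by
    rintro _ ⟨p, hp, rfl⟩
    exact e.map_source (hχs hp)
  have hc : ContinuousOn (fun y => ρ y * χ (e.symm y)) e.target :=
    hρc.mul (hχ.comp_continuousOn e.continuousOn_symm)
  have hint : Integrable (e.target.indicator fun y => ρ y * χ (e.symm y)) := by
    rw [integrable_indicator_iff e.open_target.measurableSet]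
    refine ((hc.mono hKt).integrableOn_compact hK).of_forall_sdiff_eq_zero
      e.open_target.measurableSet fun y hy => ?_
    rw [image_eq_zero_of_notMem_tsupport fun h => hy.2 ⟨_, h, e.right_inv hy.1⟩, mul_zero]
  have h1 := tendsto_integral_mul_cos i hint
  refine h1.congr fun t => ?_
  simp only [oscillation]
  rw [hρ _ (fun p hp => by
    rw [image_eq_zero_of_notMem_tsupport fun h => hp (hχs h), zero_mul])]
  · rw [← integral_indicator e.open_target.measurableSet]
    refine integral_congr_ae (Eventually.of_forall fun y => ?_)
    by_cases hy : y ∈ e.target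
    · simp [hy, e.right_inv hy, mul_assoc]
    · simp [hy]
  · have h2 : ContinuousOn (fun p => e p i) e.source :=
      (EuclideanSpace.proj i : EuclideanSpace ℝ (Fin n) →L[ℝ] ℝ).continuous.comp_continuousOn
        e.continuousOn
    exact hχ.continuousOn.mul (Real.continuous_cos.comp_continuousOn (continuousOn_const.mul h2))

end Oscillation

/-! ### Asymptotic orthogonality and failure of precompactness. -/

section Compactness

/-- A sequence in a compact set which is asymptotically orthogonal to each of its members has a
subsequence tending to zero. -/
theorem _root_.IsCompact.exists_subseq_tendsto_zero_of_inner (𝕜 : Type*) {E : Type*} [RCLike 𝕜]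
    [NormedAddCommGroup E] [InnerProductSpace 𝕜 E] {K : Set E} (hK : IsCompact K) {f : ℕ → E}
    (hf : ∀ k, f k ∈ K) (h : ∀ i, Tendsto (fun j => inner 𝕜 (f i) (f j)) atTop (𝓝 0)) :
    ∃ φ : ℕ → ℕ, StrictMono φ ∧ Tendsto (f ∘ φ) atTop (𝓝 0) := by
  obtain ⟨g, -, φ, hφ, hg⟩ := hK.tendsto_subseq hf
  -- The subsequential limit `g` is orthogonal to every member of the sequence, hence to itself as a
  -- limit of members.
  have h1 : ∀ i, inner 𝕜 (f i) g = 0 := fun i =>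
    tendsto_nhds_unique (tendsto_const_nhds.inner hg) ((h i).comp hφ.tendsto_atTop)
  have h2 : inner 𝕜 g g = 0 :=
    tendsto_nhds_unique (hg.inner tendsto_const_nhds)
      (tendsto_const_nhds.congr fun i => (h1 (φ i)).symm)
  rw [inner_self_eq_zero] at h2
  exact ⟨φ, hφ, h2 ▸ hg⟩

theorem inner_toLp_ofReal {𝕜 : Type*} [RCLike 𝕜] {α : Type*} [MeasurableSpace α] {m : Measure α}
    {F G : α → ℝ} (hF : MemLp (fun p => (F p : 𝕜)) 2 m) (hG : MemLp (fun p => (G p : 𝕜)) 2 m) :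
    inner 𝕜 (hF.toLp _) (hG.toLp _) = ((∫ p, F p * G p ∂m : ℝ) : 𝕜) := by
  rw [L2.inner_def, ← integral_ofReal]
  refine integral_congr_ae ?_
  filter_upwards [hF.coeFn_toLp, hG.coeFn_toLp] with p hp hq
  rw [hp, hq, RCLike.inner_apply, RCLike.conj_ofReal, RCLike.ofReal_mul, mul_comm]

/-- The product-to-sum formula reduces inner products of waves to integrals of single waves with
cutoff `χ²`. -/
theorem oscillation_mul_oscillation {n : ℕ} {M : Type*} [TopologicalSpace M]
    {e : OpenPartialHomeomorph M (EuclideanSpace ℝ (Fin n))} (χ : M → ℝ) (i : Fin n) (s t : ℝ) (p : M) :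
    oscillation χ e i s p * oscillation χ e i t p =
      (oscillation (fun q => χ q ^ 2) e i (t - s) p +
        oscillation (fun q => χ q ^ 2) e i (t + s) p) / 2 := by
  simp only [oscillation, sub_mul, add_mul, Real.cos_sub, Real.cos_add]
  ring

variable {n r : ℕ} {M : Type*} [TopologicalSpace M] [ChartedSpace (EuclideanSpace ℝ (Fin n)) M]
  [MeasurableSpace M] [BorelSpace M] {m : Measure M}
  {e : OpenPartialHomeomorph M (EuclideanSpace ℝ (Fin n))}

/-- A null open set would be Lebesgue null in a chart, where it is open. This gives the strict
positivity of `∫ χ²`. -/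
theorem IsSmoothVolume.isOpenPosMeasure [IsManifold (𝓡 n) ∞ M] (hm : IsSmoothVolume n m) :
    m.IsOpenPosMeasure := by
  refine ⟨fun U hU ⟨p, hp⟩ h0 => ?_⟩
  have he := IsManifold.chart_mem_maximalAtlas (I := 𝓡 n) (n := ∞) p
  set e := chartAt (EuclideanSpace ℝ (Fin n)) p
  have h1 := hm.ae_symm he (measure_eq_zero_iff_ae_notMem.1 h0)
  have h2 : IsOpen (e.target ∩ e.symm ⁻¹' U) := e.isOpen_inter_preimage_symm hU
  have h3 : e p ∈ e.target ∩ e.symm ⁻¹' U :=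
    ⟨mem_chart_target _ p, by
      rw [mem_preimage, e.left_inv (mem_chart_source _ p)]
      exact hp⟩
  refine (h2.measure_pos volume ⟨_, h3⟩).ne' ?_
  rw [measure_eq_zero_iff_ae_notMem]
  filter_upwards [(ae_restrict_iff' e.open_target.measurableSet).1 h1] with y hy hy2
  exact hy hy2.1 hy2.2

/-- If some coordinate is annihilated by all the `X j` on the domain of a chart, then waves in that
coordinate show that the Dirichlet ball is not precompact. -/
theorem not_isCompact_closure_dirichletBall (𝕜 : Type*) [RCLike 𝕜] [IsManifold (𝓡 n) ∞ M]
    [T2Space M] [CompactSpace M] (hm : IsSmoothVolume n m)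
    {X : Fin r → ∀ x : M, TangentSpace (𝓡 n) x} (hX : ∀ j, IsSmoothVectorField (X j))
    (he : e ∈ IsManifold.maximalAtlas (𝓡 n) ∞ M) (hne : e.source.Nonempty) (i : Fin n)
    (hc : ∀ p ∈ e.source, ∀ j, chartComponents e p (X j p) i = 0) :
    ¬ IsCompact (closure (dirichletBall 𝕜 m X)) := by
  intro hK
  have := hm.isLocallyFiniteMeasure
  have := hm.isOpenPosMeasure
  have : IsFiniteMeasure m := CompactSpace.isFiniteMeasure
  obtain ⟨p₀, hp₀⟩ := hne
  obtain ⟨β, -, hβ⟩ := (SmoothBumpFunction.nhds_basis_tsupport (I := 𝓡 n) p₀).mem_iff.1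
    (e.open_source.mem_nhds hp₀)
  obtain ⟨δ, hδ, hball⟩ := exists_toLp_mem_dirichletBall (𝕜 := 𝕜) hm hX
  have hβd : ∀ j, Continuous (fieldDeriv (X j) β) := fun j =>
    continuous_fieldDeriv (hX j) β.contMDiff
  choose C hC using fun j => isCompact_univ.exists_bound_of_continuousOn (hβd j).continuousOn
  -- Scaling the bump function by one `ε` brings both it and its derivatives along all `X j` below
  -- the threshold `δ`.
  obtain ⟨ε, hε, hεδ, hεC⟩ : ∃ ε : ℝ, 0 < ε ∧ ε ≤ δ ∧ ∀ j, ε * C j ≤ δ := by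
    have h0 : 0 < 1 + ∑ j, |C j| := by positivity
    refine ⟨δ / (1 + ∑ j, |C j|), by positivity, div_le_self hδ.le ?_, fun j => ?_⟩
    · exact le_add_of_nonneg_right (by positivity)
    · rw [div_mul_eq_mul_div, div_le_iff₀ h0]
      have h1 := Finset.single_le_sum (f := fun j => |C j|) (fun _ _ => abs_nonneg _)
        (Finset.mem_univ j)
      have h2 := le_abs_self (C j)
      exact mul_le_mul_of_nonneg_left (by linarith) hδ.le
  let χ : M → ℝ := ε • ⇑β
  have hχ : ContMDiff (𝓡 n) 𝓘(ℝ, ℝ) ∞ χ :=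
    (contMDiff_const (c := ε)).mul β.contMDiff
  have hχs : tsupport χ ⊆ e.source := (tsupport_smul_subset_right (fun _ => ε) _).trans hβ
  have hχ1 : ∀ p, |χ p| ≤ δ := fun p => by
    change |ε * β p| ≤ δ
    rw [abs_mul, abs_of_pos hε, abs_of_nonneg β.nonneg]
    exact (mul_le_of_le_one_right hε.le β.le_one).trans hεδ
  have hχd : ∀ j p, |fieldDeriv (X j) χ p| ≤ δ := fun j p => by
    have h1 : fieldDeriv (X j) χ p = ε * fieldDeriv (X j) β p := by
      rw [fieldDeriv, const_smul_mfderiv (β.contMDiff.mdifferentiableAt (by simp))]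
      rfl
    rw [h1, abs_mul, abs_of_pos hε]
    exact (mul_le_mul_of_nonneg_left (hC j p (mem_univ p)) hε.le).trans (hεC j)
  have hF : ∀ k : ℕ, ContMDiff (𝓡 n) 𝓘(ℝ, ℝ) ∞ (oscillation χ e i k) := fun k =>
    contMDiff_oscillation he hχ hχs i k
  have hFδ : ∀ (k : ℕ) (p : M), |oscillation χ e i k p| ≤ δ := fun k p => by
    rw [oscillation, abs_mul]
    exact (mul_le_of_le_one_right (abs_nonneg _) (Real.abs_cos_le_one _)).trans (hχ1 p)
  have hL : ∀ k : ℕ, MemLp (fun p => (oscillation χ e i k p : 𝕜)) 2 m := fun k =>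
    memLp_ofReal_of_continuous (hF k).continuous (hFδ k)
  have hmem : ∀ k, (hL k).toLp _ ∈ closure (dirichletBall 𝕜 m X) := fun k =>
    subset_closure (hball _ (hF k) (hFδ k) (fun j p =>
      (fieldDeriv_oscillation he hχ hχs i k (fun q hq => hc q hq j) p).trans (hχd j p)) (hL k))
  have hχ2 : ContMDiff (𝓡 n) 𝓘(ℝ, ℝ) ∞ fun p => χ p ^ 2 := hχ.pow 2
  have hχ2s : tsupport (fun p => χ p ^ 2) ⊆ e.source := by
    refine (closure_mono fun p hp => ?_).trans hχs
    exact fun h => hp (by simp [h])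
  set I : ℝ → ℝ := fun t => ∫ p, oscillation (fun q => χ q ^ 2) e i t p ∂m with hI
  have hI0 : Tendsto I atTop (𝓝 0) :=
    tendsto_integral_oscillation hm he hχ2.continuous hχ2s i
  have hint : ∀ t, Integrable (oscillation (fun q => χ q ^ 2) e i t) m := fun t =>
    (contMDiff_oscillation he hχ2 hχ2s i t).continuous.integrable_of_hasCompactSupport
      (HasCompactSupport.of_compactSpace _)
  have hinner : ∀ k l : ℕ, inner 𝕜 ((hL k).toLp _) ((hL l).toLp _) =
      (((I (l - k) + I (l + k)) / 2 : ℝ) : 𝕜) := fun k l => by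
    rw [inner_toLp_ofReal]
    simp only [oscillation_mul_oscillation]
    rw [integral_div, integral_add (hint _) (hint _)]
  have hpos : 0 < I 0 := by
    have h1 : ∀ p, oscillation (fun q => χ q ^ 2) e i 0 p = χ p ^ 2 := fun p => by
      simp [oscillation]
    simp only [hI, h1]
    refine hχ2.continuous.integral_pos_of_hasCompactSupport_nonneg_nonzero
      (HasCompactSupport.of_compactSpace _) (fun p => sq_nonneg _) (x := p₀) ?_
    simp [χ, hε.ne']
  obtain ⟨φ, hφ, hlim⟩ := hK.exists_subseq_tendsto_zero_of_inner 𝕜 hmem fun k => by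
    simp only [hinner]
    rw [← RCLike.ofReal_zero]
    refine (RCLike.continuous_ofReal.tendsto _).comp ?_
    have h1 : Tendsto (fun l : ℕ => I (l - k)) atTop (𝓝 0) :=
      hI0.comp (tendsto_atTop_add_const_right _ _ tendsto_natCast_atTop_atTop)
    have h2 : Tendsto (fun l : ℕ => I (l + k)) atTop (𝓝 0) :=
      hI0.comp (tendsto_atTop_add_const_right _ _ tendsto_natCast_atTop_atTop)
    simpa using (h1.add h2).div_const 2
  have hcast : Tendsto (fun j => (φ j : ℝ)) atTop atTop :=
    tendsto_natCast_atTop_atTop.comp hφ.tendsto_atTop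
  -- These are the squared norms along the subsequence. They tend to `0` by the choice of the
  -- subsequence and to `I 0 / 2 > 0` by Riemann-Lebesgue.
  have hlim2 : Tendsto (fun j => (((I 0 + I (φ j + φ j)) / 2 : ℝ) : 𝕜)) atTop (𝓝 0) := by
    have h1 := hlim.inner (𝕜 := 𝕜) hlim
    rw [inner_zero_left] at h1
    refine h1.congr fun j => ?_
    rw [Function.comp_apply, hinner, sub_self]
  have hlim3 : Tendsto (fun j => (((I 0 + I (φ j + φ j)) / 2 : ℝ) : 𝕜)) atTop
      (𝓝 (((I 0 + 0) / 2 : ℝ) : 𝕜)) :=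
    (RCLike.continuous_ofReal.tendsto _).comp
      ((tendsto_const_nhds.add (hI0.comp (hcast.atTop_add_atTop hcast))).div_const 2)
  have h0 := tendsto_nhds_unique hlim2 hlim3
  rw [eq_comm, RCLike.ofReal_eq_zero] at h0
  linarith

end Compactness

end DirichletEnergy

end

/-! ### The main theorem. -/

theorem mainTheorem6 {𝕜 : Type*} [RCLike 𝕜] {n r : ℕ} {M : Type*} [TopologicalSpace M]
    [T2Space M] [CompactSpace M] [ChartedSpace (EuclideanSpace ℝ (Fin n)) M]
    [IsManifold (𝓡 n) ∞ M] [MeasurableSpace M] [BorelSpace M]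
    (m : Measure M) (hm : DirichletEnergy.IsSmoothVolume n m)
    (X : Fin r → ∀ x : M, TangentSpace (𝓡 n) x)
    (hX : ∀ j, DirichletEnergy.IsSmoothVectorField (X j))
    (hZ : (interior (DirichletEnergy.degenerationLocus X)).Nonempty) :
    (∃ U : Set M, IsOpen U ∧ U.Nonempty ∧ U ⊆ DirichletEnergy.degenerationLocus X ∧
      ∃ (k : ℕ) (F : Set (Set M)), DirichletEnergy.IsFoliation n k U F ∧
        ∀ L ∈ F, DirichletEnergy.IsCharacteristicSubmanifold X k L) ∧
    ¬ IsCompact (closure (DirichletEnergy.dirichletBall 𝕜 m X)) := by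
  obtain ⟨d, hd, e, he, hne, heZ, ⟨a, b, hbox⟩, hc⟩ :=
    DirichletEnergy.exists_adapted_box_chart hX hZ
  refine ⟨⟨e.source, e.open_source, hne, heZ, d, DirichletEnergy.plaques d e,
    DirichletEnergy.isFoliation_plaques he hbox hd.le, ?_⟩, ?_⟩
  · rintro _ ⟨c, hct, rfl⟩
    exact DirichletEnergy.isCharacteristicSubmanifold_plaque he hd hc hct
  -- Counting from zero, `d` is the index of the first transverse coordinate; it exists because `d <
  -- n`.
  · exact DirichletEnergy.not_isCompact_closure_dirichletBall 𝕜 hm hX he hne ⟨d, hd⟩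
      fun p hp j => hc p hp j _ le_rfl
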